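/- **Setting.** Two teams, Team 1 with $N_1$ and Team 2 with $N_2$ players, control a system over the horizon $t=1,\dots,T$. The state evolves as $X_{t+1}=f_t(X_t,U_t^1,U_t^2,W_t^s)$, where $U_t^i=(U_t^{i,1},\dots,U_t^{i,N_i})$ is the action of Team $i$, and Player $j$ of Team $i$ generates the observation $Y_t^{i,j}=h_t^{i,j}(X_t,U_{t-1}^1,U_{t-1}^2,W_t^{i,j})$ (for $t=1$ a function of $X_1$ and $W_1^{i,j}$ only). All state, observation and (non-empty) action spaces are finite; $X_1$ and all the noises take finitely many values and are mutually independent. At time $t$ Player $j$ of Team $i$ knows a subset $I_t^{i,j}$ of the variables $Y_s^{k,l}$ ($s\le t$), $U_s^{k,l}$ ($s<t$). Let $C_t$ (common information) be the set of variables known to all players, $P_t^{i,j}=I_t^{i,j}\setminus C_t$ and $P_t^i=(P_t^{i,1},\dots,P_t^{i,N_i})$ (private information), with finite realization spaces $\mathcal C_t,\mathcal P_t^{i,j},\mathcal P_t^i$. Assume that $C_t\subseteq C_{t+1}$ and that, with $Z_{t+1}=C_{t+1}\setminus C_t$, there are fixed maps such that $Z_{t+1}=\zeta_{t+1}(P_t^{1:2},U_t^{1:2},Y_{t+1}^{1:2})$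 and $P^i_{t+1}=\xi^i_{t+1}(P_t^{1:2},U_t^{1:2},Y_{t+1}^{1:2})$, $i=1,2$. **Expanded game $\mathscr G_e$.** A prescription $\gamma^i=(\gamma^{i,1},\dots,\gamma^{i,N_i})\in\mathcal B_t^i$ of virtual player $i$ at time $t$ consists of maps $\gamma^{i,j}:\mathcal P_t^{i,j}\to\Delta\mathcal U_t^{i,j}$; write $\gamma^i(p^i;u^i)=\prod_j\gamma^{i,j}(p^{i,j};u^{i,j})$. A strategy $\tilde\chi^i\in\tilde{\mathcal H}^i$ of virtual player $i$ selects $\Gamma_t^i=\tilde\chi^i_t(C_t,\Gamma^{1:2}_{1:t-1})\in\mathcal B_t^i$ at each time $t$, after which the actions $U_t^{i,j}$ are drawn, independently of each other, of the noises and of the past, from the distributions $\Gamma_t^{i,j}(P_t^{i,j})$. The cost is $\mathcal J(\tilde\chi^1,\tilde\chi^2)=\mathbb E^{(\tilde\chi^1,\tilde\chi^2)}\big[\sum_{t=1}^Tc_t(X_t,U_t^1,U_t^2)\big]$, and $S^u(\mathscr G_e)=\inf_{\tilde\chi^1}\sup_{\tilde\chi^2}\mathcal J$, $S^l(\mathscr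 G_e)=\sup_{\tilde\chi^2}\inf_{\tilde\chi^1}\mathcal J$. The strategy $\tilde\chi^1$ is *min-max* if $\max_{\tilde\chi^2}\mathcal J(\tilde\chi^1,\tilde\chi^2)$ exists and equals $S^u(\mathscr G_e)$; $\tilde\chi^2$ is *max-min* if $\min_{\tilde\chi^1}\mathcal J(\tilde\chi^1,\tilde\chi^2)$ exists and equals $S^l(\mathscr G_e)$. **Beliefs.** Let $\mathcal S_t=\Delta(\mathcal X_t\times\mathcal P_t^1\times\mathcal P_t^2)$. For $\pi\in\mathcal S_t$ and prescriptions $\gamma^1,\gamma^2$ put $$\mathscr P^j_t(\pi,\gamma^{1:2};z,x',p'^{1:2})=\sum_{x,p^{1:2},u^{1:2}}\pi(x,p^{1:2})\gamma^1(p^1;u^1)\gamma^2(p^2;u^2)\,\mathbb P[X_{t+1}=x',P_{t+1}^{1:2}=p'^{1:2},Z_{t+1}=z\mid x,p^{1:2},u^{1:2}],$$ $\mathscr P_t^m(\pi,\gamma^{1:2};z)=\sum_{x',p'^{1:2}}\mathscr P^j_t(\pi,\gamma^{1:2};z,x',p'^{1:2})$, and let $F_t(\pi,\gamma^{1:2},z)=\mathscr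 P_t^j(\pi,\gamma^{1:2};z,\cdot)/\mathscr P_t^m(\pi,\gamma^{1:2};z)$ if the denominator is positive and an arbitrary element of $\mathcal S_{t+1}$, depending on $(\pi,\gamma^{1:2},z)$, otherwise. For $c_t\in\mathcal C_t$ with increments $z_2,\dots,z_t$ and a prescription history $\gamma_{1:t-1}^{1:2}$, the belief $\pi_t$ is computed forward: $\pi_1=\mathbb P[X_1=\cdot,P_1^{1:2}=\cdot\mid C_1=c_1]$ (arbitrary if $\mathbb P[C_1=c_1]=0$) and $\pi_{s+1}=F_s(\pi_s,\gamma_s^{1:2},z_{s+1})$. **Dynamic programs.** Let $\tilde c_t(\pi,\gamma^1,\gamma^2)=\sum_{x,p^{1:2},u^{1:2}}c_t(x,u^1,u^2)\pi(x,p^{1:2})\gamma^1(p^1;u^1)\gamma^2(p^2;u^2)$, $V^u_{T+1}=V^l_{T+1}=0$ and, for $t=T,\dots,1$ and $*\in\{u,l\}$, $$w^*_t(\pi,\gamma^1,\gamma^2)=\tilde c_t(\pi,\gamma^1,\gamma^2)+\sum_z\mathscr P_t^m(\pi,\gamma^{1:2};z)\,V^*_{t+1}(F_t(\pi,\gamma^{1:2},z)),$$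 $V_t^u(\pi)=\inf_{\gamma^1}\sup_{\gamma^2}w_t^u(\pi,\gamma^1,\gamma^2)$, $V_t^l(\pi)=\sup_{\gamma^2}\inf_{\gamma^1}w_t^l(\pi,\gamma^1,\gamma^2)$. **Theorem 3.** There are measurable maps $\Xi^1_t:\mathcal S_t\to\mathcal B^1_t$ and $\Xi^2_t:\mathcal S_t\to\mathcal B_t^2$, $1\le t\le T$, such that for all $t$ and all $\pi\in\mathcal S_t$ $$V_t^u(\pi)=\max_{\gamma^2}w_t^u(\pi,\Xi_t^1(\pi),\gamma^2),\qquad V_t^l(\pi)=\min_{\gamma^1}w_t^l(\pi,\gamma^1,\Xi_t^2(\pi)),$$ and for any such maps (measurable or not) the strategies $\tilde\chi^{1*}_t(c_t,\gamma_{1:t-1}^{1:2})=\Xi_t^1(\pi_t)$ and $\tilde\chi^{2*}_t(c_t,\gamma_{1:t-1}^{1:2})=\Xi_t^2(\pi_t)$ are, respectively, a min-max and a max-min strategy in the expanded game $\mathscr G_e$. -/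

import Mathlib

universe u

noncomputable section

/-- The probability simplex `Δ A` over a finite set `A`. -/
abbrev ProbSimplex (A : Type*) [Fintype A] : Type _ := ↥(stdSimplex ℝ A)

/-- The dynamic system controlled by two teams.  `Fin 2` indexes the teams: `0` is Team 1 (the
minimizer) and `1` is Team 2 (the maximizer).  Times start at `0`, so the decision times are
`0, …, T - 1`; whatever the data say about later times does not affect the total cost. -/
structure TeamSystem where
  /-- the horizon -/
  T : ℕ
  /-- the number of players in each team -/
  N : Fin 2 → ℕ
  /-- state spaces -/
  X : ℕ → Type u
  /-- action spaces of the players -/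
  U : ℕ → (i : Fin 2) → Fin (N i) → Type u
  /-- observation spaces of the players -/
  Y : ℕ → (i : Fin 2) → Fin (N i) → Type u
  /-- ranges of the system noise -/
  Ws : ℕ → Type u
  /-- ranges of the observation noises -/
  Wy : ℕ → (i : Fin 2) → Fin (N i) → Type u
  [fintypeX : ∀ t, Fintype (X t)]
  [fintypeU : ∀ t i j, Fintype (U t i j)]
  [nonemptyU : ∀ t i j, Nonempty (U t i j)]
  [fintypeY : ∀ t i j, Fintype (Y t i j)]
  [fintypeWs : ∀ t, Fintype (Ws t)]
  [fintypeWy : ∀ t i j, Fintype (Wy t i j)]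
  /-- the state evolution `X_{t+1} = f_t(X_t, U_t^1, U_t^2, W_t^s)` -/
  f : ∀ t, X t → (∀ j, U t 0 j) → (∀ j, U t 1 j) → Ws t → X (t + 1)
  /-- the first observations, which depend on the initial state and on noise only -/
  h₀ : ∀ i j, X 0 → Wy 0 i j → Y 0 i j
  /-- the later observations `Y_{t+1}^{i,j} = h_{t+1}^{i,j}(X_{t+1}, U_t^1, U_t^2, W_{t+1}^{i,j})` -/
  h : ∀ t i j, X (t + 1) → (∀ j, U t 0 j) → (∀ j, U t 1 j) → Wy (t + 1) i j → Y (t + 1) i j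
  /-- law of the initial state -/
  lawX : ProbSimplex (X 0)
  /-- laws of the system noises -/
  lawWs : ∀ t, ProbSimplex (Ws t)
  /-- laws of the observation noises -/
  lawWy : ∀ t i j, ProbSimplex (Wy t i j)
  /-- the cost functions -/
  cost : ∀ t, X t → (∀ j, U t 0 j) → (∀ j, U t 1 j) → ℝ

attribute [instance] TeamSystem.fintypeX TeamSystem.fintypeU TeamSystem.nonemptyU
  TeamSystem.fintypeY TeamSystem.fintypeWs TeamSystem.fintypeWy

namespace TeamSystem

variable (S : TeamSystem.{u})

/-- Team `i`'s joint actions at time `t`. -/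
abbrev TeamAct (t : ℕ) (i : Fin 2) : Type u := ∀ j, S.U t i j

/-- All players' observations at time `t`. -/
abbrev JointObs (t : ℕ) : Type u := ∀ i j, S.Y t i j

/-- Names of the variables that a player may know: the observations and the actions. -/
inductive Var (N : Fin 2 → ℕ) : Type
  | obs (i : Fin 2) (j : Fin (N i)) (s : ℕ) : Var N
  | act (i : Fin 2) (j : Fin (N i)) (s : ℕ) : Var N

/-- The range of a variable. -/
def Val : Var S.N → Type u
  | .obs i j s => S.Y s i j
  | .act i j s => S.U s i j

instance (v : Var S.N) : Finite (S.Val v) := by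
  cases v with
  | obs i j s => exact inferInstanceAs (Finite (S.Y s i j))
  | act i j s => exact inferInstanceAs (Finite (S.U s i j))

/-- A variable that has been generated when decisions at time `t` are taken: an observation made
no later than `t`, or an action taken before `t`. -/
def IsAvail (t : ℕ) : Var S.N → Prop
  | .obs _ _ s => s ≤ t
  | .act _ _ s => s < t

theorem finite_avail (t : ℕ) : {v | S.IsAvail t v}.Finite := by
  let g : ((Σ i, Fin (S.N i)) × Fin (t + 1)) × Bool → Var S.N := fun a =>
    if a.2 then .obs a.1.1.1 a.1.1.2 a.1.2 else .act a.1.1.1 a.1.1.2 a.1.2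
  refine (Set.finite_range g).subset ?_
  rintro (⟨i, j, s⟩ | ⟨i, j, s⟩) hv
  · exact ⟨((⟨i, j⟩, ⟨s, Nat.lt_succ_of_le hv⟩), true), rfl⟩
  · exact ⟨((⟨i, j⟩, ⟨s, Nat.lt_succ_of_lt hv⟩), false), rfl⟩

/-- The joint realizations of a set of variables. -/
def Realization (A : Set (Var S.N)) : Type u := ∀ v : A, S.Val v

instance (A : Set (Var S.N)) [Finite A] : Fintype (S.Realization A) :=
  have : Finite (S.Realization A) := inferInstanceAs (Finite (∀ v : A, S.Val v))
  Fintype.ofFinite _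

/-- A realization of the initial state, of the noises and of the actions that determine the system
up to and including the observations at time `n`. -/
structure Outcome (n : ℕ) where
  x₀ : S.X 0
  ws : ∀ s : Fin n, S.Ws s
  wy : ∀ (s : Fin (n + 1)) (i : Fin 2) (j : Fin (S.N i)), S.Wy s i j
  u : ∀ (s : Fin n) (i : Fin 2), S.TeamAct s i

instance (n : ℕ) : Fintype (S.Outcome n) :=
  have : Finite (S.Outcome n) := Finite.of_injective
    (fun ω : S.Outcome n => (ω.x₀, ω.ws, ω.wy, ω.u)) (by
      rintro ⟨a, b, c, d⟩ ⟨a', b', c', d'⟩ hh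
      simp only [Prod.mk.injEq] at hh
      obtain ⟨rfl, rfl, rfl, rfl⟩ := hh
      rfl)
  Fintype.ofFinite _

namespace Outcome

variable {S} {n : ℕ}

/-- The state `X_t`. -/
def state (ω : S.Outcome n) : (t : ℕ) → t ≤ n → S.X t
  | 0, _ => ω.x₀
  | t + 1, ht => S.f t (ω.state t (Nat.le_of_succ_le ht)) (ω.u ⟨t, ht⟩ 0) (ω.u ⟨t, ht⟩ 1)
      (ω.ws ⟨t, ht⟩)

/-- The observations `Y_t^{1:2}`. -/
def obs (ω : S.Outcome n) : (t : ℕ) → t ≤ n → S.JointObs t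
  | 0, _ => fun i j => S.h₀ i j ω.x₀ (ω.wy 0 i j)
  | t + 1, ht => fun i j => S.h t i j (ω.state (t + 1) ht) (ω.u ⟨t, ht⟩ 0) (ω.u ⟨t, ht⟩ 1)
      (ω.wy ⟨t + 1, Nat.lt_succ_of_le ht⟩ i j)

/-- The value of a variable that has been generated by time `t`. -/
def val (ω : S.Outcome n) {t : ℕ} (ht : t ≤ n) : (v : Var S.N) → S.IsAvail t v → S.Val v
  | .obs i j s, hv => ω.obs s (le_trans hv ht) i j
  | .act i j s, hv => ω.u ⟨s, lt_of_lt_of_le hv ht⟩ i j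

end Outcome

/-- The probability of a realization of the (mutually independent) initial state and noises. -/
def noiseProb {n : ℕ} (ω : S.Outcome n) : ℝ :=
  S.lawX.1 ω.x₀ * (∏ s : Fin n, (S.lawWs s).1 (ω.ws s)) *
    ∏ s : Fin (n + 1), ∏ i : Fin 2, ∏ j : Fin (S.N i), (S.lawWy s i j).1 (ω.wy s i j)

end TeamSystem

/-- An information structure: each player knows a set of the observations and actions generated so
far. -/
structure InfoSets (S : TeamSystem.{u}) where
  I : ℕ → (i : Fin 2) → Fin (S.N i) → Set (TeamSystem.Var S.N)
  I_avail : ∀ t i j v, v ∈ I t i j → S.IsAvail t v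

namespace InfoSets

open TeamSystem

variable {S : TeamSystem.{u}} (K : InfoSets S)

/-- The common information `C_t`: the variables known to all the players. -/
def commonSet (t : ℕ) : Set (Var S.N) := {v | S.IsAvail t v ∧ ∀ i j, v ∈ K.I t i j}

/-- The private information `P_t^{i,j}`. -/
def privSet (t : ℕ) (i : Fin 2) (j : Fin (S.N i)) : Set (Var S.N) := K.I t i j \ K.commonSet t

/-- The increment `Z_{t+1}` of the common information. -/
def incrSet (t : ℕ) : Set (Var S.N) := K.commonSet (t + 1) \ K.commonSet t

instance (t : ℕ) : Finite (K.commonSet t) :=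
  ((S.finite_avail t).subset fun _ hv => hv.1).to_subtype

instance (t : ℕ) (i : Fin 2) (j : Fin (S.N i)) : Finite (K.privSet t i j) :=
  ((S.finite_avail t).subset fun v hv => K.I_avail t i j v hv.1).to_subtype

instance (t : ℕ) : Finite (K.incrSet t) :=
  ((S.finite_avail (t + 1)).subset fun _ hv => hv.1.1).to_subtype

/-- Realizations of the common information at time `t`. -/
abbrev Common (t : ℕ) : Type u := S.Realization (K.commonSet t)

/-- Realizations of Player `j`'s private information at time `t`. -/
abbrev Priv (t : ℕ) (i : Fin 2) (j : Fin (S.N i)) : Type u := S.Realization (K.privSet t i j)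

/-- Realizations of Team `i`'s private information at time `t`. -/
abbrev TeamPriv (t : ℕ) (i : Fin 2) : Type u := ∀ j, K.Priv t i j

/-- Realizations of `Z_{t+1}`. -/
abbrev Incr (t : ℕ) : Type u := S.Realization (K.incrSet t)

variable {K} in
/-- `Z_{t+1}`, read off `C_{t+1}`. -/
def Common.incr {t : ℕ} (c : K.Common (t + 1)) : K.Incr t := fun v => c ⟨v.1, v.2.1⟩

variable {n : ℕ}

/-- The common information generated by an outcome. -/
def commonOf (ω : S.Outcome n) (t : ℕ) (ht : t ≤ n) : K.Common t :=
  fun v => ω.val ht v.1 v.2.1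

/-- Team `i`'s private information generated by an outcome. -/
def privOf (ω : S.Outcome n) (t : ℕ) (ht : t ≤ n) (i : Fin 2) : K.TeamPriv t i :=
  fun j v => ω.val ht v.1 (K.I_avail t i j v.1 v.2.1)

end InfoSets

/-- The zero-sum game between the two teams: a system with an information structure whose common
information is non-decreasing, and whose common increments and private information evolve by fixed
transformations of the last private information, the last actions and the new observations.  The
two evolution equations are required on all trajectories of the system, within the horizon. -/
structure TeamGame where
  sys : TeamSystem.{u}
  info : InfoSets sys
  common_mono : ∀ t, info.commonSet t ⊆ info.commonSet (t + 1)
  /-- `ζ_{t+1}` -/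
  zeta : ∀ t, info.TeamPriv t 0 → info.TeamPriv t 1 → sys.TeamAct t 0 → sys.TeamAct t 1 →
    sys.JointObs (t + 1) → info.Incr t
  /-- `ξ_{t+1}^i` -/
  xi : ∀ t i, info.TeamPriv t 0 → info.TeamPriv t 1 → sys.TeamAct t 0 → sys.TeamAct t 1 →
    sys.JointObs (t + 1) → info.TeamPriv (t + 1) i
  zeta_spec : ∀ (n : ℕ) (ω : sys.Outcome n) (t : ℕ) (ht : t + 1 ≤ n), t + 1 < sys.T →
    (info.commonOf ω (t + 1) ht).incr =
      zeta t (info.privOf ω t (Nat.le_of_succ_le ht) 0) (info.privOf ω t (Nat.le_of_succ_le ht) 1)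
        (ω.u ⟨t, ht⟩ 0) (ω.u ⟨t, ht⟩ 1) (ω.obs (t + 1) ht)
  xi_spec : ∀ (n : ℕ) (ω : sys.Outcome n) (t : ℕ) (ht : t + 1 ≤ n) (i : Fin 2), t + 1 < sys.T →
    info.privOf ω (t + 1) ht i =
      xi t i (info.privOf ω t (Nat.le_of_succ_le ht) 0)
        (info.privOf ω t (Nat.le_of_succ_le ht) 1)
        (ω.u ⟨t, ht⟩ 0) (ω.u ⟨t, ht⟩ 1) (ω.obs (t + 1) ht)

namespace TeamGame

open TeamSystem InfoSets

variable (G : TeamGame.{u})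

/-! ### The expanded virtual game -/

/-- Prescriptions of virtual player `i` at time `t`: each player of Team `i` is assigned a map from
its private information to distributions over its actions. -/
abbrev Presc (i : Fin 2) (t : ℕ) : Type u :=
  ∀ j : Fin (G.sys.N i), G.info.Priv t i j → ProbSimplex (G.sys.U t i j)

/-- Prescription histories of both virtual players, available at time `t`. -/
abbrev PrescHist (t : ℕ) : Type u := ∀ s : Fin t, G.Presc 0 s × G.Presc 1 s

/-- Strategies of virtual player `i`: control laws that select a prescription given the common
information and the prescription history. -/
abbrev Strategy (i : Fin 2) : Type u :=
  ∀ t : ℕ, G.info.Common t → G.PrescHist t → G.Presc i t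

variable {G} in
/-- `γ^i(p^i; u^i)`: the probability of a team action under a prescription. -/
def Presc.prob {i : Fin 2} {t : ℕ} (γ : G.Presc i t) (p : G.info.TeamPriv t i)
    (a : G.sys.TeamAct t i) : ℝ := ∏ j, (γ j (p j)).1 (a j)

variable {n : ℕ}

/-- The prescription history at time `t` that a strategy profile generates along an outcome. -/
def histOf (χ₁ : G.Strategy 0) (χ₂ : G.Strategy 1) (ω : G.sys.Outcome n) :
    (t : ℕ) → t ≤ n → G.PrescHist t
  | 0, _ => fun s => s.elim0
  | t + 1, ht =>
    let H := histOf χ₁ χ₂ ω t (Nat.le_of_succ_le ht)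
    let c := G.info.commonOf ω t (Nat.le_of_succ_le ht)
    Fin.snoc (α := fun s : Fin (t + 1) => G.Presc 0 s × G.Presc 1 s) H (χ₁ t c H, χ₂ t c H)

/-- The probability of an outcome under a strategy profile: given the past, the players' actions
are drawn independently from the distributions that the current prescriptions assign to their
private information, independently of the noises. -/
def outcomeProb (χ₁ : G.Strategy 0) (χ₂ : G.Strategy 1) (ω : G.sys.Outcome n) : ℝ :=
  G.sys.noiseProb ω * ∏ s : Fin n,
    ((G.histOf χ₁ χ₂ ω n le_rfl s).1.prob (G.info.privOf ω s s.2.le 0) (ω.u s 0) *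
      (G.histOf χ₁ χ₂ ω n le_rfl s).2.prob (G.info.privOf ω s s.2.le 1) (ω.u s 1))

/-- The total expected cost `𝒥(χ̃¹, χ̃²)`. -/
def totalCost (χ₁ : G.Strategy 0) (χ₂ : G.Strategy 1) : ℝ :=
  ∑ ω : G.sys.Outcome G.sys.T, G.outcomeProb χ₁ χ₂ ω *
    ∑ t : Fin G.sys.T, G.sys.cost t (ω.state t t.2.le) (ω.u t 0) (ω.u t 1)

/-- The upper value of the expanded game. -/
def upperValue : ℝ := ⨅ χ₁ : G.Strategy 0, ⨆ χ₂ : G.Strategy 1, G.totalCost χ₁ χ₂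

/-- The lower value of the expanded game. -/
def lowerValue : ℝ := ⨆ χ₂ : G.Strategy 1, ⨅ χ₁ : G.Strategy 0, G.totalCost χ₁ χ₂

/-- A min-max strategy: its worst-case cost, which is attained, is the upper value. -/
def IsMinMax (χ₁ : G.Strategy 0) : Prop :=
  IsGreatest (Set.range fun χ₂ : G.Strategy 1 => G.totalCost χ₁ χ₂) G.upperValue

/-- A max-min strategy: its worst-case reward, which is attained, is the lower value. -/
def IsMaxMin (χ₂ : G.Strategy 1) : Prop :=
  IsLeast (Set.range fun χ₁ : G.Strategy 0 => G.totalCost χ₁ χ₂) G.lowerValue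

/-! ### Common information beliefs and their update -/

/-- The finite set in which `(X_t, P_t^1, P_t^2)` takes its values. -/
abbrev Hidden (t : ℕ) : Type u := G.sys.X t × G.info.TeamPriv t 0 × G.info.TeamPriv t 1

/-- The belief space `𝒮_t`. -/
abbrev Belief (t : ℕ) : Type u := ProbSimplex (G.Hidden t)

open scoped Classical in
/-- `ℙ[x_{t+1}, p_{t+1}^{1:2}, z_{t+1} ∣ x_t, p_t^{1:2}, u_t^{1:2}]`. -/
def kernel (t : ℕ) (q : G.Hidden t) (a₁ : G.sys.TeamAct t 0) (a₂ : G.sys.TeamAct t 1)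
    (z : G.info.Incr t) (q' : G.Hidden (t + 1)) : ℝ :=
  ∑ w : G.sys.Ws t, ∑ v : (∀ i j, G.sys.Wy (t + 1) i j),
    let x' := G.sys.f t q.1 a₁ a₂ w
    let y' : G.sys.JointObs (t + 1) := fun i j => G.sys.h t i j x' a₁ a₂ (v i j)
    if q' = (x', G.xi t 0 q.2.1 q.2.2 a₁ a₂ y', G.xi t 1 q.2.1 q.2.2 a₁ a₂ y') ∧
        z = G.zeta t q.2.1 q.2.2 a₁ a₂ y'
    then (G.sys.lawWs t).1 w * ∏ i : Fin 2, ∏ j : Fin (G.sys.N i), (G.sys.lawWy (t + 1) i j).1 (v i j)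
    else 0

/-- The joint distribution of `(Z_{t+1}, X_{t+1}, P_{t+1}^{1:2})` for the belief `π` and the
prescriptions `γ₁`, `γ₂`. -/
def jointProb (t : ℕ) (π : G.Belief t) (γ₁ : G.Presc 0 t) (γ₂ : G.Presc 1 t)
    (z : G.info.Incr t) (q' : G.Hidden (t + 1)) : ℝ :=
  ∑ q : G.Hidden t, ∑ a₁ : G.sys.TeamAct t 0, ∑ a₂ : G.sys.TeamAct t 1,
    π.1 q * γ₁.prob q.2.1 a₁ * γ₂.prob q.2.2 a₂ * G.kernel t q a₁ a₂ z q'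

/-- The distribution of `Z_{t+1}` for the belief `π` and the prescriptions `γ₁`, `γ₂`. -/
def margProb (t : ℕ) (π : G.Belief t) (γ₁ : G.Presc 0 t) (γ₂ : G.Presc 1 t)
    (z : G.info.Incr t) : ℝ := ∑ q' : G.Hidden (t + 1), G.jointProb t π γ₁ γ₂ z q'

variable {G} in
theorem Presc.prob_nonneg {i : Fin 2} {t : ℕ} (γ : G.Presc i t) (p : G.info.TeamPriv t i)
    (a : G.sys.TeamAct t i) : 0 ≤ γ.prob p a :=
  Finset.prod_nonneg fun j _ => (γ j (p j)).2.1 (a j)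

theorem kernel_nonneg (t : ℕ) (q : G.Hidden t) (a₁ : G.sys.TeamAct t 0) (a₂ : G.sys.TeamAct t 1)
    (z : G.info.Incr t) (q' : G.Hidden (t + 1)) : 0 ≤ G.kernel t q a₁ a₂ z q' := by
  refine Finset.sum_nonneg fun w _ => Finset.sum_nonneg fun v _ => ?_
  dsimp only
  split_ifs
  · exact mul_nonneg ((G.sys.lawWs t).2.1 w)
      (Finset.prod_nonneg fun i _ => Finset.prod_nonneg fun j _ => (G.sys.lawWy (t + 1) i j).2.1 _)
  · exact le_rfl

theorem jointProb_nonneg (t : ℕ) (π : G.Belief t) (γ₁ : G.Presc 0 t) (γ₂ : G.Presc 1 t)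
    (z : G.info.Incr t) (q' : G.Hidden (t + 1)) : 0 ≤ G.jointProb t π γ₁ γ₂ z q' :=
  Finset.sum_nonneg fun q _ => Finset.sum_nonneg fun _ _ => Finset.sum_nonneg fun _ _ =>
    mul_nonneg (mul_nonneg (mul_nonneg (π.2.1 q) (γ₁.prob_nonneg _ _)) (γ₂.prob_nonneg _ _))
      (G.kernel_nonneg _ _ _ _ _ _)

open scoped Classical in
/-- `ℙ[X_0 = x, P_0^{1:2} = p, C_0 = c]` at the initial time. -/
def initJoint (c : G.info.Common 0) (q : G.Hidden 0) : ℝ :=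
  ∑ ω : G.sys.Outcome 0,
    if (ω.x₀, G.info.privOf ω 0 le_rfl 0, G.info.privOf ω 0 le_rfl 1) = q ∧
        G.info.commonOf ω 0 le_rfl = c
    then G.sys.noiseProb ω else 0

theorem initJoint_nonneg (c : G.info.Common 0) (q : G.Hidden 0) : 0 ≤ G.initJoint c q := by
  refine Finset.sum_nonneg fun ω _ => ?_
  split_ifs
  · exact mul_nonneg (mul_nonneg (G.sys.lawX.2.1 _)
      (Finset.prod_nonneg fun s _ => (G.sys.lawWs s).2.1 _))
      (Finset.prod_nonneg fun s _ => Finset.prod_nonneg fun i _ =>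
        Finset.prod_nonneg fun j _ => (G.sys.lawWy s i j).2.1 _)
  · exact le_rfl

/-- Arbitrary values of the beliefs where the conditioning event has probability zero. -/
structure OffSupport where
  init : G.info.Common 0 → G.Belief 0
  step : ∀ t, G.Belief t → G.Presc 0 t → G.Presc 1 t → G.info.Incr t → G.Belief (t + 1)

variable {G} in
/-- Normalization of a non-negative vector with positive total mass. -/
def normalize {A : Type*} [Fintype A] (m : A → ℝ) (hm : ∀ a, 0 ≤ m a) (hpos : 0 < ∑ a, m a) :
    ProbSimplex A :=
  ⟨fun a => m a / ∑ b, m b, fun a => div_nonneg (hm a) hpos.le, by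
    rw [← Finset.sum_div, div_self hpos.ne']⟩

open scoped Classical in
/-- The belief update `F_t`. -/
def update (E : G.OffSupport) (t : ℕ) (π : G.Belief t) (γ₁ : G.Presc 0 t) (γ₂ : G.Presc 1 t)
    (z : G.info.Incr t) : G.Belief (t + 1) :=
  if hpos : 0 < G.margProb t π γ₁ γ₂ z then
    normalize (G.jointProb t π γ₁ γ₂ z) (G.jointProb_nonneg t π γ₁ γ₂ z) hpos
  else E.step t π γ₁ γ₂ z

open scoped Classical in
/-- The initial belief `ℙ[X_0 = x, P_0^{1:2} = p ∣ C_0 = c]`. -/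
def initBelief (E : G.OffSupport) (c : G.info.Common 0) : G.Belief 0 :=
  if hpos : 0 < ∑ q, G.initJoint c q then normalize (G.initJoint c) (G.initJoint_nonneg c) hpos
  else E.init c

/-- The belief `π_t` computed forward in time from the common information and the prescription
history. -/
def beliefOf (E : G.OffSupport) : (t : ℕ) → G.info.Common t → G.PrescHist t → G.Belief t
  | 0, c, _ => G.initBelief E c
  | t + 1, c, H =>
    G.update E t
      (beliefOf E t (fun v => c ⟨v.1, G.common_mono t v.2⟩) (fun s => H s.castSucc))
      (H (Fin.last t)).1 (H (Fin.last t)).2 c.incr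

/-! ### The dynamic programs -/

/-- The expected instantaneous cost `c̃_t(π, γ₁, γ₂)`. -/
def beliefCost (t : ℕ) (π : G.Belief t) (γ₁ : G.Presc 0 t) (γ₂ : G.Presc 1 t) : ℝ :=
  ∑ q : G.Hidden t, ∑ a₁ : G.sys.TeamAct t 0, ∑ a₂ : G.sys.TeamAct t 1,
    G.sys.cost t q.1 a₁ a₂ * π.1 q * γ₁.prob q.2.1 a₁ * γ₂.prob q.2.2 a₂

/-- The cost-to-go `c̃_t(π, γ₁, γ₂) + 𝔼[V(F_t(π, γ₁, γ₂, Z_{t+1})) ∣ π, γ₁, γ₂]` for a given value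
function `V` at the next time. -/
def costToGo (E : G.OffSupport) (t : ℕ) (V : G.Belief (t + 1) → ℝ) (π : G.Belief t)
    (γ₁ : G.Presc 0 t) (γ₂ : G.Presc 1 t) : ℝ :=
  G.beliefCost t π γ₁ γ₂ +
    ∑ z : G.info.Incr t, G.margProb t π γ₁ γ₂ z * V (G.update E t π γ₁ γ₂ z)

/-- The upper value function at time `t` with `k` decision times to go. -/
def upperAux (E : G.OffSupport) : (k t : ℕ) → G.Belief t → ℝ
  | 0, _, _ => 0
  | k + 1, t, π => ⨅ γ₁ : G.Presc 0 t, ⨆ γ₂ : G.Presc 1 t,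
      G.costToGo E t (upperAux E k (t + 1)) π γ₁ γ₂

/-- The lower value function at time `t` with `k` decision times to go. -/
def lowerAux (E : G.OffSupport) : (k t : ℕ) → G.Belief t → ℝ
  | 0, _, _ => 0
  | k + 1, t, π => ⨆ γ₂ : G.Presc 1 t, ⨅ γ₁ : G.Presc 0 t,
      G.costToGo E t (lowerAux E k (t + 1)) π γ₁ γ₂

/-- The upper value function `V_t^u`; it vanishes from time `T` on. -/
def upperFun (E : G.OffSupport) (t : ℕ) : G.Belief t → ℝ := G.upperAux E (G.sys.T - t) t

/-- The lower value function `V_t^l`; it vanishes from time `T` on. -/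
def lowerFun (E : G.OffSupport) (t : ℕ) : G.Belief t → ℝ := G.lowerAux E (G.sys.T - t) t

/-- The upper cost-to-go function `w_t^u`. -/
def upperCost (E : G.OffSupport) (t : ℕ) (π : G.Belief t) (γ₁ : G.Presc 0 t) (γ₂ : G.Presc 1 t) :
    ℝ := G.costToGo E t (G.upperFun E (t + 1)) π γ₁ γ₂

/-- The lower cost-to-go function `w_t^l`. -/
def lowerCost (E : G.OffSupport) (t : ℕ) (π : G.Belief t) (γ₁ : G.Presc 0 t) (γ₂ : G.Presc 1 t) :
    ℝ := G.costToGo E t (G.lowerFun E (t + 1)) π γ₁ γ₂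

/-- `V_t^u(π) = max_{γ₂} w_t^u(π, Ξ¹_t(π), γ₂)` for all decision times `t` and all beliefs `π`. -/
def IsUpperSelector (E : G.OffSupport) (Ξ : ∀ t, G.Belief t → G.Presc 0 t) : Prop :=
  ∀ t < G.sys.T, ∀ π : G.Belief t,
    IsGreatest (Set.range fun γ₂ : G.Presc 1 t => G.upperCost E t π (Ξ t π) γ₂) (G.upperFun E t π)

/-- `V_t^l(π) = min_{γ₁} w_t^l(π, γ₁, Ξ²_t(π))` for all decision times `t` and all beliefs `π`. -/
def IsLowerSelector (E : G.OffSupport) (Ξ : ∀ t, G.Belief t → G.Presc 1 t) : Prop :=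
  ∀ t < G.sys.T, ∀ π : G.Belief t,
    IsLeast (Set.range fun γ₁ : G.Presc 0 t => G.lowerCost E t π γ₁ (Ξ t π)) (G.lowerFun E t π)

/-- The strategy that applies a selector to the belief computed forward in time. -/
def beliefStrategy (E : G.OffSupport) {i : Fin 2} (Ξ : ∀ t, G.Belief t → G.Presc i t) :
    G.Strategy i := fun t c H => Ξ t (G.beliefOf E t c H)

end TeamGame

end

/-! The proof is dynamic programming on the common-information belief. Strategies select
prescriptions deterministically from data known to both virtual players, and common information
never shrinks, so under a fixed profile the whole prescription history is a function of `C_t`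
(`histOf_eq_commonHist`). The belief recursion uses only `C_t` and the prescriptions played, so its
value does not depend on which strategies produced them. Bayes' rule then shows, by induction on
time, that `π_t` is the conditional law of `(X_t, P_t)` given `C_t` under every profile
(`jointLaw_eq`), whatever values are chosen off the support.

Consequently, for any functions `V_t` that vanish at the horizon, the cost of the first `k` stages
plus the expectation of `V_k(π_k)` changes from `k` to `k + 1` by the expected difference between
the cost-to-go and `V_k` (`costWithTerminal_succ`). Telescoping compares the total cost with the
expectation of `V_0(π_0)`: an upper selector keeps it at or below this number for the upper value
function against every opponent, while a stagewise best response to any strategy of the minimizer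
brings it to at least the same number. So the number is the upper value and the selector's worst
case is attained. The lower value is symmetric; no minimax theorem relates the two.

Existence of selectors and best responses rests on continuity (`continuous_costToGo`). The belief
update may jump where an increment has probability zero, but there its weight tends to zero and the
next value function is bounded, so the product is continuous. Compactness of the prescription spaces
preserves continuity under inf and sup and supplies optimizers. Measurability of a minimizer comes
from fixing its coordinates one at a time (`exists_measurable_argmin`), a lexicographic selection.
-/

noncomputable section

/-! ### Trajectories extended by one time step -/

namespace TeamSystem

variable {S : TeamSystem.{u}} {n : ℕ}

variable (S) in
/-- The actions at time `n` and the noises that determine the next state and observations. -/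
abbrev Step (n : ℕ) : Type u :=
  (S.TeamAct n 0 × S.TeamAct n 1) × S.Ws n × (∀ i j, S.Wy (n + 1) i j)

namespace Outcome

/-- Extension of an outcome by one time step. -/
def extend (ω : S.Outcome n) (d : S.Step n) : S.Outcome (n + 1) where
  x₀ := ω.x₀
  ws := Fin.snoc (α := fun s : Fin (n + 1) => S.Ws s) ω.ws d.2.1
  wy := Fin.snoc (α := fun s : Fin (n + 2) => ∀ i j, S.Wy s i j) ω.wy d.2.2
  u := Fin.snoc (α := fun s : Fin (n + 1) => ∀ i, S.TeamAct s i) ω.u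
    ((piFinTwoEquiv fun i => S.TeamAct n i).symm d.1)

/-- Outcomes up to time `n + 1` are outcomes up to time `n` followed by one step. -/
def extendEquiv : S.Outcome n × S.Step n ≃ S.Outcome (n + 1) where
  toFun p := p.1.extend p.2
  invFun ω := (⟨ω.x₀, fun s => ω.ws s.castSucc, fun s => ω.wy s.castSucc, fun s => ω.u s.castSucc⟩,
    (piFinTwoEquiv (fun i => S.TeamAct n i) (ω.u (Fin.last n)), ω.ws (Fin.last n),
      ω.wy (Fin.last (n + 1))))
  left_inv := by
    rintro ⟨⟨x, ws, wy, v⟩, ⟨a, b, c⟩⟩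
    simp [extend, Fin.snoc_castSucc, Fin.snoc_last]
  right_inv := by
    rintro ⟨x, ws, wy, v⟩
    simp only [extend, Outcome.mk.injEq, true_and, Equiv.symm_apply_apply]
    refine ⟨?_, ?_, ?_⟩ <;>
    · funext s
      induction s using Fin.lastCases <;> simp only [Fin.snoc_castSucc, Fin.snoc_last]

theorem sum_extend (F : S.Outcome (n + 1) → ℝ) : ∑ ω, F ω = ∑ ω, ∑ d, F (extend ω d) := by
  rw [← extendEquiv.sum_comp, Fintype.sum_prod_type]
  rfl

variable (ω : S.Outcome n) (d : S.Step n)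

theorem extend_u_of_lt {t : ℕ} (ht : t < n) (ht' : t < n + 1) :
    (ω.extend d).u ⟨t, ht'⟩ = ω.u ⟨t, ht⟩ :=
  Fin.snoc_castSucc (α := fun s : Fin (n + 1) => ∀ i, S.TeamAct s i) _ _ ⟨t, ht⟩

theorem extend_u_last_zero : (ω.extend d).u (Fin.last n) 0 = d.1.1 := by
  simp only [extend, Fin.snoc_last]; rfl

theorem extend_u_last_one : (ω.extend d).u (Fin.last n) 1 = d.1.2 := by
  simp only [extend, Fin.snoc_last]; rfl

theorem extend_state : ∀ (t : ℕ) (ht : t ≤ n) (ht' : t ≤ n + 1),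
    (ω.extend d).state t ht' = ω.state t ht
  | 0, _, _ => rfl
  | t + 1, ht, ht' => by
    simp only [state]
    rw [extend_state t (Nat.le_of_succ_le ht), extend_u_of_lt _ _ ht]
    congr 1
    exact Fin.snoc_castSucc (α := fun s : Fin (n + 1) => S.Ws s) _ _ ⟨t, ht⟩

theorem extend_obs : ∀ (t : ℕ) (ht : t ≤ n) (ht' : t ≤ n + 1),
    (ω.extend d).obs t ht' = ω.obs t ht
  | 0, _, _ => by
    funext i j
    simp only [obs]
    congr 1
  | t + 1, ht, ht' => by
    funext i j
    simp only [obs]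
    rw [extend_state _ _ _ ht, extend_u_of_lt _ _ ht]
    congr 1
    exact congrFun (congrFun
      (Fin.snoc_castSucc (α := fun s : Fin (n + 2) => ∀ i j, S.Wy s i j) _ _
        ⟨t + 1, Nat.lt_succ_of_le ht⟩) i) j

/-- Causality: variables generated by time `n` ignore the noises and actions of the added step. -/
theorem extend_val {t : ℕ} (ht : t ≤ n) (ht' : t ≤ n + 1) (v : Var S.N) (hv : S.IsAvail t v) :
    (ω.extend d).val ht' v hv = ω.val ht v hv := by
  cases v with
  | obs i j s => simp only [val]; rw [extend_obs _ _ _ (le_trans hv ht)]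
  | act i j s => simp only [val]; rw [extend_u_of_lt _ _ (lt_of_lt_of_le hv ht)]

theorem extend_state_last : (ω.extend d).state (n + 1) le_rfl =
    S.f n (ω.state n le_rfl) d.1.1 d.1.2 d.2.1 := by
  simp only [state]
  rw [extend_state _ _ _ le_rfl]
  congr 1
  · exact extend_u_last_zero ω d
  · exact extend_u_last_one ω d
  · exact Fin.snoc_last (α := fun s : Fin (n + 1) => S.Ws s) _ _

theorem extend_obs_last : (ω.extend d).obs (n + 1) le_rfl = fun i j =>
    S.h n i j (S.f n (ω.state n le_rfl) d.1.1 d.1.2 d.2.1) d.1.1 d.1.2 (d.2.2 i j) := by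
  funext i j
  simp only [obs]
  rw [extend_state_last]
  congr 1
  · exact extend_u_last_zero ω d
  · exact extend_u_last_one ω d
  · exact congrFun (congrFun
      (Fin.snoc_last (α := fun s : Fin (n + 2) => ∀ i j, S.Wy s i j) _ _) i) j

end Outcome

variable (S) in
/-- The probability of the noises of one step. -/
def stepNoise (n : ℕ) (w : S.Ws n) (v : ∀ i j, S.Wy (n + 1) i j) : ℝ :=
  (S.lawWs n).1 w * ∏ i : Fin 2, ∏ j : Fin (S.N i), (S.lawWy (n + 1) i j).1 (v i j)

theorem noiseProb_nonneg (ω : S.Outcome n) : 0 ≤ S.noiseProb ω :=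
  mul_nonneg (mul_nonneg (S.lawX.2.1 _) (Finset.prod_nonneg fun s _ => (S.lawWs s).2.1 _))
    (Finset.prod_nonneg fun s _ => Finset.prod_nonneg fun i _ =>
      Finset.prod_nonneg fun j _ => (S.lawWy s i j).2.1 _)

theorem noiseProb_extend (ω : S.Outcome n) (d : S.Step n) :
    S.noiseProb (ω.extend d) = S.noiseProb ω * S.stepNoise n d.2.1 d.2.2 := by
  simp only [noiseProb, stepNoise]
  rw [Fin.prod_univ_castSucc, Fin.prod_univ_castSucc (n := n + 1)]
  simp only [Outcome.extend, Fin.snoc_castSucc, Fin.snoc_last, Fin.val_castSucc, Fin.val_last]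
  ring

theorem sum_prod_law {ι : Type*} [Fintype ι] [DecidableEq ι] {A : ι → Type*} [∀ i, Fintype (A i)]
    (p : ∀ i, ProbSimplex (A i)) : ∑ a : ∀ i, A i, ∏ i, (p i).1 (a i) = 1 := by
  classical
  rw [← Fintype.prod_sum fun i a => (p i).1 a]
  exact Finset.prod_eq_one fun i _ => (p i).2.2

theorem sum_stepNoise (n : ℕ) : ∑ w, ∑ v, S.stepNoise n w v = 1 := by
  classical
  have key : ∑ v : ∀ i j, S.Wy (n + 1) i j,
      ∏ i : Fin 2, ∏ j : Fin (S.N i), (S.lawWy (n + 1) i j).1 (v i j) = 1 := by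
    rw [← Fintype.prod_sum (ι := Fin 2)
      fun i (a : ∀ j, S.Wy (n + 1) i j) => ∏ j, (S.lawWy (n + 1) i j).1 (a j)]
    exact Finset.prod_eq_one fun i _ => sum_prod_law _
  simp only [stepNoise, ← Finset.mul_sum, key, mul_one]
  exact (S.lawWs n).2.2

end TeamSystem

namespace InfoSets

open TeamSystem

variable {S : TeamSystem.{u}} (K : InfoSets S) {n : ℕ} (ω : S.Outcome n) (d : S.Step n)

theorem commonOf_extend {t : ℕ} (ht : t ≤ n) (ht' : t ≤ n + 1) :
    K.commonOf (ω.extend d) t ht' = K.commonOf ω t ht :=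
  funext fun _ => ω.extend_val d ht ht' _ _

theorem privOf_extend {t : ℕ} (ht : t ≤ n) (ht' : t ≤ n + 1) (i : Fin 2) :
    K.privOf (ω.extend d) t ht' i = K.privOf ω t ht i :=
  funext fun _ => funext fun _ => ω.extend_val d ht ht' _ _

end InfoSets

/-! ### Play as a function of the common information -/

namespace TeamGame

open TeamSystem InfoSets

variable {G : TeamGame.{u}} {n : ℕ}

/-- The common information at time `t`, read off that at time `t + 1`. -/
def prevCommon {t : ℕ} (c : G.info.Common (t + 1)) : G.info.Common t :=
  fun v => c ⟨v.1, G.common_mono t v.2⟩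

open scoped Classical in
variable (G) in
/-- The common information consists of the previous common information and the increment. -/
def commonEquiv (t : ℕ) : G.info.Common (t + 1) ≃ G.info.Common t × G.info.Incr t where
  toFun c := (prevCommon c, c.incr)
  invFun p v := if hv : v.1 ∈ G.info.commonSet t then p.1 ⟨v.1, hv⟩ else p.2 ⟨v.1, v.2, hv⟩
  left_inv c := by
    funext v
    by_cases hv : v.1 ∈ G.info.commonSet t <;> simp [hv, prevCommon, Common.incr]
  right_inv p := by
    refine Prod.ext (funext fun v => ?_) (funext fun v => ?_)
    · simp [prevCommon, v.2]
    · simp [Common.incr, v.2.2]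

variable (G) in
/-- `(X_t, P_t^{1:2})`. -/
def hiddenOf (ω : G.sys.Outcome n) (t : ℕ) (ht : t ≤ n) : G.Hidden t :=
  (ω.state t ht, G.info.privOf ω t ht 0, G.info.privOf ω t ht 1)

variable (χ₁ : G.Strategy 0) (χ₂ : G.Strategy 1)

/-- The prescription history as a function of the common information. -/
def commonHist : (t : ℕ) → G.info.Common t → G.PrescHist t
  | 0, _ => fun s => s.elim0
  | t + 1, c =>
    let H := commonHist t (prevCommon c)
    Fin.snoc (α := fun s : Fin (t + 1) => G.Presc 0 s × G.Presc 1 s) H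
      (χ₁ t (prevCommon c) H, χ₂ t (prevCommon c) H)

theorem prevCommon_commonOf (ω : G.sys.Outcome n) (t : ℕ) (ht : t + 1 ≤ n) :
    prevCommon (G.info.commonOf ω (t + 1) ht) = G.info.commonOf ω t (Nat.le_of_succ_le ht) := by
  funext ⟨v, hv⟩
  cases v <;> rfl

/-- Common information contains its own past, so it replays all earlier choices of the deterministic
laws. Conditioning on the prescriptions in addition to `C_t` therefore adds nothing. -/
theorem histOf_eq_commonHist (ω : G.sys.Outcome n) : ∀ (t : ℕ) (ht : t ≤ n),
    G.histOf χ₁ χ₂ ω t ht = commonHist χ₁ χ₂ t (G.info.commonOf ω t ht)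
  | 0, _ => rfl
  | t + 1, ht => by
    simp only [histOf, commonHist]
    rw [histOf_eq_commonHist ω t (Nat.le_of_succ_le ht), prevCommon_commonOf]

theorem outcomeProb_nonneg (ω : G.sys.Outcome n) : 0 ≤ G.outcomeProb χ₁ χ₂ ω :=
  mul_nonneg (noiseProb_nonneg ω) (Finset.prod_nonneg fun _ _ =>
    mul_nonneg (Presc.prob_nonneg _ _ _) (Presc.prob_nonneg _ _ _))

/-- The prescription of virtual player 1 as a function of the common information. -/
def presc₁ (t : ℕ) (c : G.info.Common t) : G.Presc 0 t := χ₁ t c (commonHist χ₁ χ₂ t c)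

/-- The prescription of virtual player 2 as a function of the common information. -/
def presc₂ (t : ℕ) (c : G.info.Common t) : G.Presc 1 t := χ₂ t c (commonHist χ₁ χ₂ t c)

theorem histOf_succ_castSucc (ω : G.sys.Outcome n) (t : ℕ) (ht : t + 1 ≤ n) (s : Fin t) :
    G.histOf χ₁ χ₂ ω (t + 1) ht s.castSucc = G.histOf χ₁ χ₂ ω t (Nat.le_of_succ_le ht) s := by
  simp only [histOf, Fin.snoc_castSucc]

/-- The product form of the outcome probability yields a one-step transition law whose control part
involves the past only through the current common and private information. -/
theorem outcomeProb_extend (ω : G.sys.Outcome n) (d : G.sys.Step n) :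
    G.outcomeProb χ₁ χ₂ (ω.extend d) = G.outcomeProb χ₁ χ₂ ω *
      ((presc₁ χ₁ χ₂ n (G.info.commonOf ω n le_rfl)).prob (G.info.privOf ω n le_rfl 0) d.1.1 *
        (presc₂ χ₁ χ₂ n (G.info.commonOf ω n le_rfl)).prob (G.info.privOf ω n le_rfl 1) d.1.2 *
        G.sys.stepNoise n d.2.1 d.2.2) := by
  have hprev (s : Fin n) : G.histOf χ₁ χ₂ (ω.extend d) (n + 1) le_rfl s.castSucc =
      G.histOf χ₁ χ₂ ω n le_rfl s := by
    rw [histOf_succ_castSucc, histOf_eq_commonHist, histOf_eq_commonHist,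
      commonOf_extend _ _ _ le_rfl]
  have hlast : G.histOf χ₁ χ₂ (ω.extend d) (n + 1) le_rfl (Fin.last n) =
      (presc₁ χ₁ χ₂ n (G.info.commonOf ω n le_rfl),
        presc₂ χ₁ χ₂ n (G.info.commonOf ω n le_rfl)) := by
    simp only [histOf, Fin.snoc_last]
    rw [histOf_eq_commonHist, commonOf_extend _ _ _ le_rfl]
    rfl
  have hu (s : Fin n) : (ω.extend d).u s.castSucc = ω.u s := ω.extend_u_of_lt d s.2 _
  have hp (s : Fin n) (i : Fin 2) : G.info.privOf (ω.extend d) s.castSucc s.castSucc.2.le i =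
      G.info.privOf ω s s.2.le i := privOf_extend _ _ _ s.2.le _ _
  have hpl (i : Fin 2) : G.info.privOf (ω.extend d) (Fin.last n) (Fin.last n).2.le i =
      G.info.privOf ω n le_rfl i := privOf_extend _ _ _ le_rfl _ _
  simp only [outcomeProb]
  rw [Fin.prod_univ_castSucc, noiseProb_extend]
  have hA : ∀ s : Fin n,
      (G.histOf χ₁ χ₂ (ω.extend d) (n + 1) le_rfl s.castSucc).1.prob
        (G.info.privOf (ω.extend d) s.castSucc s.castSucc.2.le 0) ((ω.extend d).u s.castSucc 0) *
      (G.histOf χ₁ χ₂ (ω.extend d) (n + 1) le_rfl s.castSucc).2.prob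
        (G.info.privOf (ω.extend d) s.castSucc s.castSucc.2.le 1) ((ω.extend d).u s.castSucc 1) =
      (G.histOf χ₁ χ₂ ω n le_rfl s).1.prob (G.info.privOf ω s s.2.le 0) (ω.u s 0) *
      (G.histOf χ₁ χ₂ ω n le_rfl s).2.prob (G.info.privOf ω s s.2.le 1) (ω.u s 1) := fun s => by
    rw [hprev, hp, hp, hu]
  rw [Finset.prod_congr rfl fun s _ => hA s, hlast, hpl, hpl, ω.extend_u_last_zero,
    ω.extend_u_last_one]
  simp only [Fin.val_last]
  ring

end TeamGame

/-! ### Measurable selection of minimizers over a compact space -/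

section MeasurableArgmin

variable {X K : Type*} [MeasurableSpace X] [TopologicalSpace K]

/-- The minimum over a compact set of a function that is measurable in the parameter and continuous
in the variable is measurable. -/
theorem measurable_sInf_image_of_isCompact [SecondCountableTopology K] {f : X → K → ℝ}
    (hf : ∀ k, Measurable fun x => f x k) (hc : ∀ x, Continuous (f x)) {s : Set K}
    (hs : IsCompact s) (hne : s.Nonempty) : Measurable fun x => sInf (f x '' s) := by
  have : Nonempty s := hne.to_subtype
  refine measurable_of_Iio fun a => ?_
  have key : (fun x => sInf (f x '' s)) ⁻¹' Set.Iio a =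
      ⋃ i : ℕ, {x | f x (TopologicalSpace.denseSeq s i) < a} := by
    ext x
    simp only [Set.mem_preimage, Set.mem_Iio, Set.mem_iUnion, Set.mem_ofPred_eq]
    have hb : BddBelow (f x '' s) := (hs.image (hc x)).bddBelow
    constructor
    · intro h
      obtain ⟨_, ⟨k, hk, rfl⟩, hlt⟩ := exists_lt_of_csInf_lt (hne.image _) h
      -- The strict sublevel set is open in `s`, so if it is non-empty it meets the dense sequence;
      -- this reduces the infimum to countably many measurable conditions.
      have ho : IsOpen {y : s | f x y < a} :=
        isOpen_lt ((hc x).comp continuous_subtype_val) continuous_const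
      obtain ⟨_, hy, ⟨i, rfl⟩⟩ :=
        (TopologicalSpace.denseRange_denseSeq s).inter_open_nonempty _ ho ⟨⟨k, hk⟩, hlt⟩
      exact ⟨i, hy⟩
    · rintro ⟨i, hi⟩
      exact (csInf_le hb ⟨_, (TopologicalSpace.denseSeq s i).2, rfl⟩).trans_lt hi
  rw [key]
  exact MeasurableSet.iUnion fun i => measurableSet_lt (hf _) measurable_const

variable [CompactSpace K] [SecondCountableTopology K]

/-- Restriction of the zeros of `F x ≥ 0` to those at which `e` is smallest. -/
theorem exists_refine_zeros {F : X → K → ℝ} (hF : ∀ k, Measurable fun x => F x k)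
    (hc : ∀ x, Continuous (F x)) (hpos : ∀ x k, 0 ≤ F x k) (hz : ∀ x, ∃ k, F x k = 0)
    {e : K → ℝ} (he : Continuous e) :
    ∃ m : X → ℝ, Measurable m ∧ ∀ x, ∃ k, F x k = 0 ∧ e k = m x := by
  have hcl (x) : IsCompact {k | F x k = 0} := (isClosed_eq (hc x) continuous_const).isCompact
  have hleast (x) := ((hcl x).image he).isLeast_sInf (Set.Nonempty.image e (hz x))
  refine ⟨fun x => sInf (e '' {k | F x k = 0}), ?_, fun x => (hleast x).1⟩
  refine measurable_of_Iic fun a => ?_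
  -- The empty case is separate because the real `sInf` of the empty set is `0`, which would wrongly
  -- satisfy the test `≤ 0` used below.
  rcases Set.eq_empty_or_nonempty {k | e k ≤ a} with h0 | hne
  · convert MeasurableSet.empty
    ext x
    simp only [Set.mem_preimage, Set.mem_Iic, Set.mem_empty_iff_false, iff_false]
    intro hx
    obtain ⟨k, -, hk⟩ := (hleast x).1
    exact (Set.ext_iff.1 h0 k).1 (hk.trans_le hx)
  · have hcs : IsCompact {k | e k ≤ a} := (isClosed_le he continuous_const).isCompact
    have := measurable_sInf_image_of_isCompact hF hc hcs hne
    have hset : (fun x => sInf (e '' {k | F x k = 0})) ⁻¹' Set.Iic a =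
        {x | sInf (F x '' {k | e k ≤ a}) ≤ 0} := ?_
    · rw [hset]
      exact measurableSet_le this measurable_const
    -- The least value of `e` on the zeros is at most `a` exactly when `F x` has a zero in `{e ≤
    -- a}`, that is, when its minimum there is `0`.
    ext x
    have hl := (hcs.image (hc x)).isLeast_sInf (hne.image _)
    simp only [Set.mem_preimage, Set.mem_Iic, Set.mem_ofPred_eq]
    constructor
    · intro hx
      obtain ⟨k, hk, hk'⟩ := (hleast x).1
      exact (hl.2 ⟨k, hk'.trans_le hx, rfl⟩).trans_eq hk
    · intro hx
      obtain ⟨k, hk, hk'⟩ := hl.1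
      exact ((hleast x).2 ⟨k, le_antisymm (hk'.trans_le hx) (hpos x k), rfl⟩).trans hk

/-- Measurable selection of minimizers of a function that is measurable in the parameter and
continuous in the variable, which ranges over a compact space whose σ-algebra is generated by
finitely many continuous functions. -/
theorem exists_measurable_argmin [Nonempty K] [MeasurableSpace K] {ι : Type*} [Finite ι] (e : ι → K → ℝ)
    (he : ∀ i, Continuous (e i))
    (hgen : ∀ g : X → K, (∀ i, Measurable fun x => e i (g x)) → Measurable g)
    {f : X → K → ℝ} (hf : ∀ k, Measurable fun x => f x k) (hc : ∀ x, Continuous (f x)) :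
    ∃ g : X → K, Measurable g ∧ ∀ x k, f x (g x) ≤ f x k := by
  classical
  have : Fintype ι := Fintype.ofFinite ι
  -- The zeros of `F x` are minimizers of `f x` on which the coordinates in `s` already take a
  -- single value, measurable in `x`. The induction starts from `f x` minus its minimum and adds a
  -- penalty `|e i - m x|` for each new coordinate.
  have key : ∀ s : Finset ι, ∃ F : X → K → ℝ, (∀ k, Measurable fun x => F x k) ∧
      (∀ x, Continuous (F x)) ∧ (∀ x k, 0 ≤ F x k) ∧ (∀ x, ∃ k, F x k = 0) ∧
      (∀ x k, F x k = 0 → ∀ k', f x k ≤ f x k') ∧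
      ∀ i ∈ s, ∃ m : X → ℝ, Measurable m ∧ ∀ x k, F x k = 0 → e i k = m x := by
    intro s
    induction s using Finset.induction_on with
    | empty =>
      have hl (x) := (isCompact_univ.image (hc x)).isLeast_sInf (Set.univ_nonempty.image _)
      refine ⟨fun x k => f x k - sInf (f x '' Set.univ), fun k => (hf k).sub
        (measurable_sInf_image_of_isCompact hf hc isCompact_univ Set.univ_nonempty),
        fun x => (hc x).sub continuous_const, fun x k => sub_nonneg.2 ((hl x).2 ⟨k, trivial, rfl⟩),
        fun x => ?_, fun x k hk k' => (sub_eq_zero.1 hk).trans_le ((hl x).2 ⟨k', trivial, rfl⟩),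
        by simp⟩
      obtain ⟨k, -, hk⟩ := (hl x).1
      exact ⟨k, sub_eq_zero.2 hk⟩
    | insert i s _ ih =>
      obtain ⟨F, h1, h2, h3, h4, h5, h6⟩ := ih
      obtain ⟨m, hm, hm'⟩ := exists_refine_zeros h1 h2 h3 h4 (he i)
      have hzero {x k} (h : F x k + |e i k - m x| = 0) : F x k = 0 ∧ e i k = m x := by
        have := h3 x k
        have := abs_nonneg (e i k - m x)
        exact ⟨by linarith, sub_eq_zero.1 (abs_eq_zero.1 (by linarith))⟩
      refine ⟨fun x k => F x k + |e i k - m x|, fun k => (h1 k).add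
        (continuous_abs.measurable.comp (measurable_const.sub hm)), fun x => (h2 x).add
        ((he i).sub continuous_const).abs, fun x k => add_nonneg (h3 x k) (abs_nonneg _),
        fun x => ?_, fun x k hk => h5 x k (hzero hk).1, fun j hj => ?_⟩
      · obtain ⟨k, hk, hk'⟩ := hm' x
        exact ⟨k, by simp [hk, hk']⟩
      · rcases Finset.mem_insert.1 hj with rfl | hj
        · exact ⟨m, hm, fun x k hk => (hzero hk).2⟩
        · obtain ⟨m', hm₁, hm₂⟩ := h6 j hj
          exact ⟨m', hm₁, fun x k hk => hm₂ x k (hzero hk).1⟩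
  obtain ⟨F, -, -, -, h4, h5, h6⟩ := key Finset.univ
  -- Even an arbitrary choice is measurable: on the zeros of `F x` every generating coordinate
  -- equals a prescribed measurable function of `x`.
  choose g hg using h4
  refine ⟨g, hgen g fun i => ?_, fun x k => h5 x _ (hg x) k⟩
  obtain ⟨m, hm, hm'⟩ := h6 i (Finset.mem_univ i)
  simpa only [hm' _ _ (hg _)] using hm

end MeasurableArgmin

/-! ### Laws of the common information and correctness of the belief -/

namespace TeamGame

open TeamSystem InfoSets

variable {G : TeamGame.{u}} {n : ℕ} (χ₁ : G.Strategy 0) (χ₂ : G.Strategy 1)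

open scoped Classical in
/-- The joint law of `(C_k, (X_k, P_k^{1:2}))`. -/
def jointLaw (k : ℕ) (c : G.info.Common k) (q : G.Hidden k) : ℝ :=
  ∑ ω : G.sys.Outcome k, if G.hiddenOf ω k le_rfl = q ∧ G.info.commonOf ω k le_rfl = c
    then G.outcomeProb χ₁ χ₂ ω else 0

/-- The law of the common information. -/
def commonLaw (k : ℕ) (c : G.info.Common k) : ℝ := ∑ q, jointLaw χ₁ χ₂ k c q

theorem jointLaw_nonneg (k : ℕ) (c : G.info.Common k) (q : G.Hidden k) :
    0 ≤ jointLaw χ₁ χ₂ k c q :=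
  Finset.sum_nonneg fun ω _ => by split_ifs <;> simp [outcomeProb_nonneg]

theorem commonLaw_nonneg (k : ℕ) (c : G.info.Common k) : 0 ≤ commonLaw χ₁ χ₂ k c :=
  Finset.sum_nonneg fun _ _ => jointLaw_nonneg _ _ _ _ _

/-- Change of variables to the joint law of common information and hidden variables, used for both
the stage cost and the transition. -/
theorem sum_outcomeProb_mul {k : ℕ} (Ψ : G.info.Common k → G.Hidden k → ℝ) :
    ∑ ω : G.sys.Outcome k, G.outcomeProb χ₁ χ₂ ω *
      Ψ (G.info.commonOf ω k le_rfl) (G.hiddenOf ω k le_rfl) =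
      ∑ c, ∑ q, jointLaw χ₁ χ₂ k c q * Ψ c q := by
  classical
  simp only [jointLaw, Finset.sum_mul]
  rw [Finset.sum_congr rfl fun c _ => Finset.sum_comm, Finset.sum_comm]
  refine Finset.sum_congr rfl fun ω _ => ?_
  simp only [ite_and, ite_mul, zero_mul, Finset.sum_ite_eq, Finset.mem_univ, if_true]

theorem sum_step (g₁ : G.sys.TeamAct n 0 → ℝ) (g₂ : G.sys.TeamAct n 1 → ℝ)
    (φ : G.sys.Step n → ℝ) :
    ∑ d : G.sys.Step n, g₁ d.1.1 * g₂ d.1.2 * G.sys.stepNoise n d.2.1 d.2.2 * φ d =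
      ∑ a₁, ∑ a₂, g₁ a₁ * g₂ a₂ * ∑ w, ∑ v, G.sys.stepNoise n w v * φ ((a₁, a₂), (w, v)) := by
  simp only [Fintype.sum_prod_type, Finset.mul_sum, mul_assoc]

theorem Presc.sum_prob {i : Fin 2} {t : ℕ} (γ : G.Presc i t) (p : G.info.TeamPriv t i) :
    ∑ a, γ.prob p a = 1 := sum_prod_law fun j => γ j (p j)

/-- The expected cost of the first `k` stages. -/
def partialCost (k : ℕ) : ℝ :=
  ∑ ω : G.sys.Outcome k, G.outcomeProb χ₁ χ₂ ω *
    ∑ t : Fin k, G.sys.cost t (ω.state t t.2.le) (ω.u t 0) (ω.u t 1)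

theorem partialCost_succ (k : ℕ) : partialCost χ₁ χ₂ (k + 1) = partialCost χ₁ χ₂ k +
    ∑ c, ∑ q, jointLaw χ₁ χ₂ k c q * ∑ a₁, ∑ a₂, (presc₁ χ₁ χ₂ k c).prob q.2.1 a₁ *
      (presc₂ χ₁ χ₂ k c).prob q.2.2 a₂ * G.sys.cost k q.1 a₁ a₂ := by
  rw [← sum_outcomeProb_mul χ₁ χ₂ fun c q => ∑ a₁, ∑ a₂, (presc₁ χ₁ χ₂ k c).prob q.2.1 a₁ *
      (presc₂ χ₁ χ₂ k c).prob q.2.2 a₂ * G.sys.cost k q.1 a₁ a₂]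
  simp only [partialCost]
  rw [Outcome.sum_extend, ← Finset.sum_add_distrib]
  refine Finset.sum_congr rfl fun ω _ => ?_
  have hcost (d : G.sys.Step k) : ∑ t : Fin (k + 1), G.sys.cost t ((ω.extend d).state t t.2.le)
      ((ω.extend d).u t 0) ((ω.extend d).u t 1) =
      (∑ t : Fin k, G.sys.cost t (ω.state t t.2.le) (ω.u t 0) (ω.u t 1)) +
        G.sys.cost k (ω.state k le_rfl) d.1.1 d.1.2 := by
    rw [Fin.sum_univ_castSucc, ω.extend_u_last_zero, ω.extend_u_last_one,
      ω.extend_state d _ (Fin.last k).le_rfl]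
    congr 1
    refine Finset.sum_congr rfl fun s _ => ?_
    have hu : (ω.extend d).u s.castSucc = ω.u s := ω.extend_u_of_lt d s.2 _
    have hs : (ω.extend d).state s.castSucc s.castSucc.2.le = ω.state s s.2.le :=
      ω.extend_state d _ s.2.le _
    rw [hs, hu]
    rfl
  simp only [outcomeProb_extend, hcost, mul_assoc (G.outcomeProb χ₁ χ₂ ω), ← Finset.mul_sum]
  rw [sum_step _ _ (fun d => _ + G.sys.cost k (ω.state k le_rfl) d.1.1 d.1.2), ← mul_add]
  -- The added step has total mass one: its noises sum out here and the prescription probabilities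
  -- below, which leaves the earlier costs unchanged.
  simp only [← Finset.sum_mul, sum_stepNoise, one_mul, mul_add, Finset.sum_add_distrib]
  congr 2
  simp only [← Finset.mul_sum, Presc.sum_prob, mul_one, one_mul]

/-- The hidden variables after one step. -/
def nextHidden (q : G.Hidden n) (d : G.sys.Step n) : G.Hidden (n + 1) :=
  let x' := G.sys.f n q.1 d.1.1 d.1.2 d.2.1
  let y' : G.sys.JointObs (n + 1) := fun i j => G.sys.h n i j x' d.1.1 d.1.2 (d.2.2 i j)
  (x', G.xi n 0 q.2.1 q.2.2 d.1.1 d.1.2 y', G.xi n 1 q.2.1 q.2.2 d.1.1 d.1.2 y')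

/-- The increment of the common information in one step. -/
def nextIncr (q : G.Hidden n) (d : G.sys.Step n) : G.info.Incr n :=
  let x' := G.sys.f n q.1 d.1.1 d.1.2 d.2.1
  let y' : G.sys.JointObs (n + 1) := fun i j => G.sys.h n i j x' d.1.1 d.1.2 (d.2.2 i j)
  G.zeta n q.2.1 q.2.2 d.1.1 d.1.2 y'

open scoped Classical in
theorem kernel_eq (q : G.Hidden n) (a₁ : G.sys.TeamAct n 0) (a₂ : G.sys.TeamAct n 1)
    (z : G.info.Incr n) (q' : G.Hidden (n + 1)) :
    G.kernel n q a₁ a₂ z q' = ∑ w, ∑ v, G.sys.stepNoise n w v *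
      if q' = nextHidden q ((a₁, a₂), (w, v)) ∧ z = nextIncr q ((a₁, a₂), (w, v))
        then 1 else 0 := by
  simp only [mul_ite, mul_one, mul_zero]
  rfl

/-- The bound on `n` is what makes `xi_spec` available: the evolution equations are assumed only at
decision times. -/
theorem hiddenOf_extend (hn : n + 1 < G.sys.T) (ω : G.sys.Outcome n) (d : G.sys.Step n) :
    G.hiddenOf (ω.extend d) (n + 1) le_rfl = nextHidden (G.hiddenOf ω n le_rfl) d := by
  have hu0 (h) : (ω.extend d).u ⟨n, h⟩ 0 = d.1.1 := ω.extend_u_last_zero d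
  have hu1 (h) : (ω.extend d).u ⟨n, h⟩ 1 = d.1.2 := ω.extend_u_last_one d
  rw [hiddenOf, G.xi_spec _ _ n le_rfl _ hn, G.xi_spec _ _ n le_rfl _ hn, hu0, hu1,
    privOf_extend _ _ _ le_rfl, privOf_extend _ _ _ le_rfl, ω.extend_obs_last,
    ω.extend_state_last]
  rfl

theorem incr_commonOf_extend (hn : n + 1 < G.sys.T) (ω : G.sys.Outcome n) (d : G.sys.Step n) :
    (G.info.commonOf (ω.extend d) (n + 1) le_rfl).incr = nextIncr (G.hiddenOf ω n le_rfl) d := by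
  have hu0 (h) : (ω.extend d).u ⟨n, h⟩ 0 = d.1.1 := ω.extend_u_last_zero d
  have hu1 (h) : (ω.extend d).u ⟨n, h⟩ 1 = d.1.2 := ω.extend_u_last_one d
  rw [G.zeta_spec _ _ n le_rfl hn, hu0, hu1,
    privOf_extend _ _ _ le_rfl, privOf_extend _ _ _ le_rfl, ω.extend_obs_last]
  rfl

theorem jointLaw_succ {k : ℕ} (hk : k + 1 < G.sys.T) (c' : G.info.Common (k + 1))
    (q' : G.Hidden (k + 1)) : jointLaw χ₁ χ₂ (k + 1) c' q' =
      ∑ q, jointLaw χ₁ χ₂ k (prevCommon c') q * ∑ a₁, ∑ a₂,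
        (presc₁ χ₁ χ₂ k (prevCommon c')).prob q.2.1 a₁ *
        (presc₂ χ₁ χ₂ k (prevCommon c')).prob q.2.2 a₂ * G.kernel k q a₁ a₂ c'.incr q' := by
  classical
  -- The indicator keeps only the outcomes that pass through the unique predecessor of `c'`; the
  -- kernel accounts for the increment.
  have h := sum_outcomeProb_mul χ₁ χ₂ (k := k) fun c q => if c = prevCommon c' then
    ∑ a₁, ∑ a₂, (presc₁ χ₁ χ₂ k c).prob q.2.1 a₁ *
        (presc₂ χ₁ χ₂ k c).prob q.2.2 a₂ * G.kernel k q a₁ a₂ c'.incr q' else 0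
  rw [Finset.sum_comm] at h
  simp only [mul_ite, mul_zero, Finset.sum_ite_eq', Finset.mem_univ, if_true] at h
  rw [← h, jointLaw, Outcome.sum_extend]
  refine Finset.sum_congr rfl fun ω _ => ?_
  have hprev (d : G.sys.Step k) : prevCommon (G.info.commonOf (ω.extend d) (k + 1) le_rfl) =
      G.info.commonOf ω k le_rfl := by
    rw [prevCommon_commonOf, commonOf_extend]
  have hcommon (d : G.sys.Step k) : G.info.commonOf (ω.extend d) (k + 1) le_rfl = c' ↔
      G.info.commonOf ω k le_rfl = prevCommon c' ∧
        (G.info.commonOf (ω.extend d) (k + 1) le_rfl).incr = c'.incr := by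
    rw [← hprev d, ← (G.commonEquiv k).injective.eq_iff]
    exact Prod.ext_iff
  simp only [hcommon, hiddenOf_extend hk, incr_commonOf_extend hk, outcomeProb_extend]
  split_ifs with hc
  · simp only [kernel_eq, hc, true_and, @eq_comm _ q', @eq_comm _ c'.incr]
    rw [← sum_step _ _ fun d => if nextHidden (G.hiddenOf ω k le_rfl) d = q' ∧
      nextIncr (G.hiddenOf ω k le_rfl) d = c'.incr then 1 else 0]
    simp only [Finset.mul_sum, mul_ite, mul_one, mul_zero]
    rfl
  · simp [hc]

variable (E : G.OffSupport)

/-- The belief along the play of a strategy profile, as a function of the common information. -/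
def playBelief (k : ℕ) (c : G.info.Common k) : G.Belief k :=
  G.beliefOf E k c (commonHist χ₁ χ₂ k c)

theorem playBelief_succ (k : ℕ) (c : G.info.Common (k + 1)) :
    playBelief χ₁ χ₂ E (k + 1) c = G.update E k (playBelief χ₁ χ₂ E k (prevCommon c))
      (presc₁ χ₁ χ₂ k (prevCommon c)) (presc₂ χ₁ χ₂ k (prevCommon c)) c.incr := by
  simp only [playBelief, beliefOf, commonHist, Fin.snoc_castSucc, Fin.snoc_last]
  rfl

theorem margProb_nonneg (t : ℕ) (π : G.Belief t) (γ₁ : G.Presc 0 t) (γ₂ : G.Presc 1 t)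
    (z : G.info.Incr t) : 0 ≤ G.margProb t π γ₁ γ₂ z :=
  Finset.sum_nonneg fun _ _ => G.jointProb_nonneg _ _ _ _ _ _

/-- Bayes' rule in product form needs no positivity: when the marginal is zero, all the non-negative
joint terms are zero too, so the arbitrary off-support belief is harmless. -/
theorem jointProb_eq_margProb_mul_update (t : ℕ) (π : G.Belief t) (γ₁ : G.Presc 0 t)
    (γ₂ : G.Presc 1 t) (z : G.info.Incr t) (q' : G.Hidden (t + 1)) :
    G.jointProb t π γ₁ γ₂ z q' = G.margProb t π γ₁ γ₂ z * (G.update E t π γ₁ γ₂ z).1 q' := by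
  by_cases hpos : 0 < G.margProb t π γ₁ γ₂ z
  · rw [update, dif_pos hpos]
    simp only [normalize]
    exact (mul_div_cancel₀ _ hpos.ne').symm
  · have h0 : G.margProb t π γ₁ γ₂ z = 0 :=
      le_antisymm (not_lt.1 hpos) (margProb_nonneg _ _ _ _ _)
    rw [h0, zero_mul]
    exact (Finset.sum_eq_zero_iff_of_nonneg fun _ _ => G.jointProb_nonneg _ _ _ _ _ _).1 h0 q'
      (Finset.mem_univ _)

theorem initJoint_eq (c : G.info.Common 0) (q : G.Hidden 0) :
    G.initJoint c q = (∑ q, G.initJoint c q) * (G.initBelief E c).1 q := by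
  by_cases hpos : 0 < ∑ q, G.initJoint c q
  · rw [initBelief, dif_pos hpos]
    simp only [normalize]
    exact (mul_div_cancel₀ _ hpos.ne').symm
  · have h0 : ∑ q, G.initJoint c q = 0 :=
      le_antisymm (not_lt.1 hpos) (Finset.sum_nonneg fun _ _ => G.initJoint_nonneg _ _)
    rw [h0, zero_mul]
    exact (Finset.sum_eq_zero_iff_of_nonneg fun _ _ => G.initJoint_nonneg _ _).1 h0 q
      (Finset.mem_univ _)

theorem jointLaw_zero (c : G.info.Common 0) (q : G.Hidden 0) :
    jointLaw χ₁ χ₂ 0 c q = G.initJoint c q := by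
  simp only [jointLaw, initJoint, outcomeProb, Finset.univ_eq_empty, Finset.prod_empty, mul_one]
  rfl

theorem jointLaw_succ_eq {k : ℕ} (hk : k + 1 < G.sys.T)
    (ih : ∀ c q, jointLaw χ₁ χ₂ k c q = commonLaw χ₁ χ₂ k c * (playBelief χ₁ χ₂ E k c).1 q)
    (c' : G.info.Common (k + 1)) (q' : G.Hidden (k + 1)) :
    jointLaw χ₁ χ₂ (k + 1) c' q' = commonLaw χ₁ χ₂ k (prevCommon c') *
      G.jointProb k (playBelief χ₁ χ₂ E k (prevCommon c'))
        (presc₁ χ₁ χ₂ k (prevCommon c')) (presc₂ χ₁ χ₂ k (prevCommon c')) c'.incr q' := by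
  rw [jointLaw_succ χ₁ χ₂ hk, jointProb]
  simp only [ih, Finset.mul_sum, mul_assoc]

/-- The belief is the conditional law of the hidden variables given the common information. -/
theorem jointLaw_eq : ∀ {k : ℕ}, k < G.sys.T → ∀ (c : G.info.Common k) (q : G.Hidden k),
    jointLaw χ₁ χ₂ k c q = commonLaw χ₁ χ₂ k c * (playBelief χ₁ χ₂ E k c).1 q
  | 0, _, c, q => by
    simp only [commonLaw, jointLaw_zero]
    exact initJoint_eq E c q
  | k + 1, hk, c, q => by
    have h := jointLaw_succ_eq χ₁ χ₂ E hk (jointLaw_eq (Nat.lt_of_succ_lt hk)) c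
    simp only [commonLaw, h]
    rw [← Finset.mul_sum, playBelief_succ, jointProb_eq_margProb_mul_update E, margProb, mul_assoc]

theorem commonLaw_succ {k : ℕ} (hk : k + 1 < G.sys.T) (c : G.info.Common (k + 1)) :
    commonLaw χ₁ χ₂ (k + 1) c = commonLaw χ₁ χ₂ k (prevCommon c) *
      G.margProb k (playBelief χ₁ χ₂ E k (prevCommon c))
        (presc₁ χ₁ χ₂ k (prevCommon c)) (presc₂ χ₁ χ₂ k (prevCommon c)) c.incr := by
  simp only [commonLaw, margProb,
    jointLaw_succ_eq χ₁ χ₂ E hk (jointLaw_eq χ₁ χ₂ E (Nat.lt_of_succ_lt hk)), ← Finset.mul_sum]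

/-! ### Telescoping and verification -/

/-- The expected cost of the first `k` stages plus the expected value of the belief at time `k`. -/
def costWithTerminal (V : ∀ t, G.Belief t → ℝ) (k : ℕ) : ℝ :=
  partialCost χ₁ χ₂ k + ∑ c, commonLaw χ₁ χ₂ k c * V k (playBelief χ₁ χ₂ E k c)

/-- Tower property: given `C_k`, the belief yields the expected stage cost, and splitting `C_{k+1}`
into `C_k` and the increment turns the expected next value into the continuation term. -/
theorem costWithTerminal_succ {V : ∀ t, G.Belief t → ℝ} (hV : ∀ π, V G.sys.T π = 0) {k : ℕ}
    (hk : k < G.sys.T) : costWithTerminal χ₁ χ₂ E V (k + 1) = partialCost χ₁ χ₂ k +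
      ∑ c, commonLaw χ₁ χ₂ k c * G.costToGo E k (V (k + 1)) (playBelief χ₁ χ₂ E k c)
        (presc₁ χ₁ χ₂ k c) (presc₂ χ₁ χ₂ k c) := by
  rw [costWithTerminal, partialCost_succ, add_assoc]
  simp only [costToGo, mul_add, Finset.sum_add_distrib]
  congr 2
  · refine Finset.sum_congr rfl fun c _ => ?_
    simp only [jointLaw_eq χ₁ χ₂ E hk, beliefCost, Finset.mul_sum]
    refine Finset.sum_congr rfl fun q _ => Finset.sum_congr rfl fun a₁ _ =>
      Finset.sum_congr rfl fun a₂ _ => by ring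
  · rcases Nat.lt_or_ge (k + 1) G.sys.T with hk' | hk'
    · rw [← (G.commonEquiv k).symm.sum_comp, Fintype.sum_prod_type]
      refine Finset.sum_congr rfl fun c _ => ?_
      rw [Finset.mul_sum]
      refine Finset.sum_congr rfl fun z _ => ?_
      have h1 : prevCommon ((G.commonEquiv k).symm (c, z)) = c :=
        congrArg Prod.fst ((G.commonEquiv k).apply_symm_apply (c, z))
      have h2 : ((G.commonEquiv k).symm (c, z)).incr = z :=
        congrArg Prod.snd ((G.commonEquiv k).apply_symm_apply (c, z))
      rw [commonLaw_succ χ₁ χ₂ E hk', playBelief_succ, h1, h2, mul_assoc]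
    -- At the horizon the evolution equations are no longer assumed, but the value vanishes, so the
    -- law of the next belief does not matter.
    · have hT : k + 1 = G.sys.T := le_antisymm hk hk'
      have hV' : ∀ π, V (k + 1) π = 0 := by rw [hT]; exact hV
      simp [hV']

variable (G) in
/-- The expectation of the value of the initial belief. -/
def initialValue (V : ∀ t, G.Belief t → ℝ) : ℝ :=
  ∑ c, (∑ q, G.initJoint c q) * V 0 (G.initBelief E c)

theorem costWithTerminal_zero (V : ∀ t, G.Belief t → ℝ) :
    costWithTerminal χ₁ χ₂ E V 0 = G.initialValue E V := by
  simp only [costWithTerminal, partialCost, Finset.univ_eq_empty, Finset.sum_empty, mul_zero,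
    Finset.sum_const_zero, zero_add, commonLaw, jointLaw_zero]
  rfl

theorem costWithTerminal_horizon {V : ∀ t, G.Belief t → ℝ} (hV : ∀ π, V G.sys.T π = 0) :
    costWithTerminal χ₁ χ₂ E V G.sys.T = G.totalCost χ₁ χ₂ := by
  simp only [costWithTerminal, hV, mul_zero, Finset.sum_const_zero, add_zero]
  rfl

/-- Verification: if the values never decrease in expectation along the play, then the total cost
is at least the initial value. -/
theorem initialValue_le_totalCost {V : ∀ t, G.Belief t → ℝ} (hV : ∀ π, V G.sys.T π = 0)
    (h : ∀ k < G.sys.T, ∀ c, V k (playBelief χ₁ χ₂ E k c) ≤ G.costToGo E k (V (k + 1))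
      (playBelief χ₁ χ₂ E k c) (presc₁ χ₁ χ₂ k c) (presc₂ χ₁ χ₂ k c)) :
    G.initialValue E V ≤ G.totalCost χ₁ χ₂ := by
  have key : ∀ k ≤ G.sys.T, G.initialValue E V ≤ costWithTerminal χ₁ χ₂ E V k := by
    intro k
    induction k with
    | zero => exact fun _ => (costWithTerminal_zero χ₁ χ₂ E V).ge
    | succ k ih =>
      intro hk
      refine (ih (Nat.le_of_succ_le hk)).trans ?_
      rw [costWithTerminal_succ χ₁ χ₂ E hV hk, costWithTerminal]
      gcongr with c
      · exact commonLaw_nonneg χ₁ χ₂ k c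
      · exact h k hk c
  exact (key _ le_rfl).trans_eq (costWithTerminal_horizon χ₁ χ₂ E hV)

/-- Verification: if the values never increase in expectation along the play, then the total cost
is at most the initial value. -/
theorem totalCost_le_initialValue {V : ∀ t, G.Belief t → ℝ} (hV : ∀ π, V G.sys.T π = 0)
    (h : ∀ k < G.sys.T, ∀ c, G.costToGo E k (V (k + 1)) (playBelief χ₁ χ₂ E k c)
      (presc₁ χ₁ χ₂ k c) (presc₂ χ₁ χ₂ k c) ≤ V k (playBelief χ₁ χ₂ E k c)) :
    G.totalCost χ₁ χ₂ ≤ G.initialValue E V := by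
  have key : ∀ k ≤ G.sys.T, costWithTerminal χ₁ χ₂ E V k ≤ G.initialValue E V := by
    intro k
    induction k with
    | zero => exact fun _ => (costWithTerminal_zero χ₁ χ₂ E V).le
    | succ k ih =>
      intro hk
      refine le_trans ?_ (ih (Nat.le_of_succ_le hk))
      rw [costWithTerminal_succ χ₁ χ₂ E hV hk, costWithTerminal]
      gcongr with c
      · exact commonLaw_nonneg χ₁ χ₂ k c
      · exact h k hk c
  exact (costWithTerminal_horizon χ₁ χ₂ E hV).ge.trans (key _ le_rfl)

end TeamGame

/-! ### Order and compactness facts for inf-sup problems -/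

/-- A point whose worst case is a guaranteed value is optimal, and its worst case is attained. -/
theorem isGreatest_range_iInf_iSup {A B α : Type*} [ConditionallyCompleteLattice α] {J : A → B → α}
    {a₀ : A} {v : α} (hle : ∀ b, J a₀ b ≤ v) (hge : ∀ a, ∃ b, v ≤ J a b)
    (hb : ∀ a, BddAbove (Set.range (J a))) :
    IsGreatest (Set.range (J a₀)) (⨅ a, ⨆ b, J a b) := by
  obtain ⟨b₀, hb₀⟩ := hge a₀
  have : Nonempty A := ⟨a₀⟩
  have : Nonempty B := ⟨b₀⟩
  have hsup (a) : v ≤ ⨆ b, J a b := by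
    obtain ⟨b, h⟩ := hge a
    exact h.trans (le_ciSup (hb a) b)
  have hv : ⨅ a, ⨆ b, J a b = v := le_antisymm
    ((ciInf_le ⟨v, by rintro _ ⟨a, rfl⟩; exact hsup a⟩ a₀).trans (ciSup_le hle)) (le_ciInf hsup)
  rw [hv]
  exact ⟨⟨b₀, le_antisymm (hle b₀) hb₀⟩, by rintro _ ⟨b, rfl⟩; exact hle b⟩

theorem isLeast_range_iSup_iInf {A B α : Type*} [ConditionallyCompleteLattice α] {J : A → B → α}
    {a₀ : A} {v : α} (hle : ∀ b, v ≤ J a₀ b) (hge : ∀ a, ∃ b, J a b ≤ v)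
    (hb : ∀ a, BddBelow (Set.range (J a))) :
    IsLeast (Set.range (J a₀)) (⨆ a, ⨅ b, J a b) :=
  isGreatest_range_iInf_iSup (α := αᵒᵈ) hle hge hb

theorem continuous_iSup_of_compactSpace {X K : Type*} [TopologicalSpace X] [TopologicalSpace K]
    [CompactSpace K] {f : X → K → ℝ} (hf : Continuous (Function.uncurry f)) :
    Continuous fun x => ⨆ k, f x k := by
  simpa only [Set.image_univ, sSup_range] using isCompact_univ.continuous_sSup hf

theorem continuous_iInf_of_compactSpace {X K : Type*} [TopologicalSpace X] [TopologicalSpace K]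
    [CompactSpace K] {f : X → K → ℝ} (hf : Continuous (Function.uncurry f)) :
    Continuous fun x => ⨅ k, f x k := by
  simpa only [Set.image_univ, sInf_range] using isCompact_univ.continuous_sInf hf

theorem isGreatest_range_iSup {K : Type*} [TopologicalSpace K] [CompactSpace K] [Nonempty K]
    {f : K → ℝ} (hf : Continuous f) : IsGreatest (Set.range f) (⨆ k, f k) :=
  (isCompact_range hf).isGreatest_sSup (Set.range_nonempty f)

theorem isLeast_range_iInf {K : Type*} [TopologicalSpace K] [CompactSpace K] [Nonempty K]
    {f : K → ℝ} (hf : Continuous f) : IsLeast (Set.range f) (⨅ k, f k) :=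
  (isCompact_range hf).isLeast_sInf (Set.range_nonempty f)

/-! ### Continuity of the dynamic programs -/

namespace TeamGame

open TeamSystem InfoSets

variable {G : TeamGame.{u}} {t : ℕ} {i : Fin 2}

instance : Nonempty (G.Presc i t) := by
  classical
  exact ⟨fun j _ => ⟨Pi.single (Classical.arbitrary (G.sys.U t i j)) 1, single_mem_stdSimplex ℝ _⟩⟩

theorem continuous_prob (p : G.info.TeamPriv t i) (a : G.sys.TeamAct t i) :
    Continuous fun γ : G.Presc i t => γ.prob p a :=
  continuous_finsetProd _ fun j _ => (continuous_apply (a j)).comp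
    (continuous_subtype_val.comp ((continuous_apply (p j)).comp (continuous_apply j)))

variable (G t) in
/-- A belief with the prescriptions of both virtual players. -/
abbrev Situation : Type u := G.Belief t × G.Presc 0 t × G.Presc 1 t

theorem continuous_belief_apply (q : G.Hidden t) :
    Continuous fun x : G.Situation t => x.1.1 q :=
  (continuous_apply q).comp (continuous_subtype_val.comp continuous_fst)

theorem continuous_jointProb (z : G.info.Incr t) (q' : G.Hidden (t + 1)) :
    Continuous fun x : G.Situation t => G.jointProb t x.1 x.2.1 x.2.2 z q' :=
  continuous_finsetSum _ fun q _ => continuous_finsetSum _ fun a₁ _ =>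
    continuous_finsetSum _ fun a₂ _ =>
      (((continuous_belief_apply q).mul ((continuous_prob q.2.1 a₁).comp continuous_snd.fst)).mul
        ((continuous_prob q.2.2 a₂).comp continuous_snd.snd)).mul continuous_const

theorem continuous_margProb (z : G.info.Incr t) :
    Continuous fun x : G.Situation t => G.margProb t x.1 x.2.1 x.2.2 z :=
  continuous_finsetSum _ fun q' _ => continuous_jointProb z q'

theorem continuous_beliefCost :
    Continuous fun x : G.Situation t => G.beliefCost t x.1 x.2.1 x.2.2 :=
  continuous_finsetSum _ fun q _ => continuous_finsetSum _ fun a₁ _ =>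
    continuous_finsetSum _ fun a₂ _ =>
      ((continuous_const.mul (continuous_belief_apply q)).mul
        ((continuous_prob q.2.1 a₁).comp continuous_snd.fst)).mul
        ((continuous_prob q.2.2 a₂).comp continuous_snd.snd)

variable (E : G.OffSupport)

/-- Positivity of the marginal persists nearby, where the update is a quotient of continuous
functions. -/
theorem continuousAt_update (z : G.info.Incr t) {x : G.Situation t}
    (hx : 0 < G.margProb t x.1 x.2.1 x.2.2 z) :
    ContinuousAt (fun x : G.Situation t => G.update E t x.1 x.2.1 x.2.2 z) x := by
  rw [Topology.IsInducing.subtypeVal.continuousAt_iff, continuousAt_pi]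
  intro q'
  have h : ContinuousAt (fun x : G.Situation t => G.jointProb t x.1 x.2.1 x.2.2 z q' /
      G.margProb t x.1 x.2.1 x.2.2 z) x :=
    (continuous_jointProb z q').continuousAt.div (continuous_margProb z).continuousAt hx.ne'
  refine h.congr ?_
  filter_upwards [(continuous_margProb z).continuousAt.eventually (lt_mem_nhds hx)] with y hy
  simp only [Function.comp_apply]
  rw [jointProb_eq_margProb_mul_update E, mul_div_cancel_left₀ _ hy.ne']

theorem continuous_costToGo {V : G.Belief (t + 1) → ℝ} (hV : Continuous V) :
    Continuous fun x : G.Situation t => G.costToGo E t V x.1 x.2.1 x.2.2 := by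
  refine continuous_beliefCost.add (continuous_finsetSum _ fun z _ => ?_)
  -- The belief simplex is compact, so `V` is bounded. Where the marginal vanishes, this bound
  -- replaces continuity of the update in a squeeze argument.
  obtain ⟨C, hC⟩ := isCompact_univ.exists_bound_of_continuousOn hV.continuousOn
  refine continuous_iff_continuousAt.2 fun x => ?_
  rcases (margProb_nonneg t x.1 x.2.1 x.2.2 z).eq_or_lt with h0 | hpos
  · have hlim : Filter.Tendsto (fun x : G.Situation t => G.margProb t x.1 x.2.1 x.2.2 z * C)
        (nhds x) (nhds 0) := by
      have := ((continuous_margProb z).tendsto x).mul_const C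
      simpa [← h0] using this
    simp only [ContinuousAt, ← h0, zero_mul]
    refine squeeze_zero_norm (fun y => ?_) hlim
    rw [norm_mul, Real.norm_of_nonneg (margProb_nonneg _ _ _ _ _)]
    exact mul_le_mul_of_nonneg_left (hC _ trivial) (margProb_nonneg _ _ _ _ _)
  · exact (continuous_margProb z).continuousAt.mul
      (hV.continuousAt.comp (continuousAt_update E z hpos))

/-- Backward induction: the cost-to-go is jointly continuous, and inf or sup over a compact
prescription space keeps continuity in the remaining variables. -/
theorem continuous_upperAux : ∀ k t, Continuous (G.upperAux E k t)
  | 0, _ => continuous_const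
  | k + 1, t => by
    refine continuous_iInf_of_compactSpace (continuous_iSup_of_compactSpace
      (f := fun (x : G.Belief t × G.Presc 0 t) γ₂ =>
        G.costToGo E t (G.upperAux E k (t + 1)) x.1 x.2 γ₂) ?_)
    exact (continuous_costToGo E (continuous_upperAux k (t + 1))).comp
      (g := fun x : G.Situation t => G.costToGo E t (G.upperAux E k (t + 1)) x.1 x.2.1 x.2.2)
      (f := fun y : (G.Belief t × G.Presc 0 t) × G.Presc 1 t => (y.1.1, y.1.2, y.2))
      (by fun_prop)

theorem continuous_lowerAux : ∀ k t, Continuous (G.lowerAux E k t)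
  | 0, _ => continuous_const
  | k + 1, t => by
    refine continuous_iSup_of_compactSpace (continuous_iInf_of_compactSpace
      (f := fun (x : G.Belief t × G.Presc 1 t) γ₁ =>
        G.costToGo E t (G.lowerAux E k (t + 1)) x.1 γ₁ x.2) ?_)
    exact (continuous_costToGo E (continuous_lowerAux k (t + 1))).comp
      (g := fun x : G.Situation t => G.costToGo E t (G.lowerAux E k (t + 1)) x.1 x.2.1 x.2.2)
      (f := fun y : (G.Belief t × G.Presc 1 t) × G.Presc 0 t => (y.1.1, y.2, y.1.2))
      (by fun_prop)

theorem continuous_upperCost :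
    Continuous fun x : G.Situation t => G.upperCost E t x.1 x.2.1 x.2.2 :=
  continuous_costToGo E (continuous_upperAux E _ _)

theorem continuous_lowerCost :
    Continuous fun x : G.Situation t => G.lowerCost E t x.1 x.2.1 x.2.2 :=
  continuous_costToGo E (continuous_lowerAux E _ _)

theorem continuous_upperCost_right (π : G.Belief t) (γ₁ : G.Presc 0 t) :
    Continuous (G.upperCost E t π γ₁) :=
  (continuous_upperCost E).comp (f := fun γ₂ => (π, γ₁, γ₂)) (by fun_prop)

theorem continuous_lowerCost_left (π : G.Belief t) (γ₂ : G.Presc 1 t) :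
    Continuous fun γ₁ => G.lowerCost E t π γ₁ γ₂ :=
  (continuous_lowerCost E).comp (f := fun γ₁ => (π, γ₁, γ₂)) (by fun_prop)

theorem continuous_iSup_upperCost : Continuous fun x : G.Belief t × G.Presc 0 t =>
    ⨆ γ₂, G.upperCost E t x.1 x.2 γ₂ :=
  continuous_iSup_of_compactSpace
    (f := fun (x : G.Belief t × G.Presc 0 t) γ₂ => G.upperCost E t x.1 x.2 γ₂) <|
    (continuous_upperCost E).comp
      (f := fun y : (G.Belief t × G.Presc 0 t) × G.Presc 1 t => (y.1.1, y.1.2, y.2)) (by fun_prop)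

theorem continuous_iInf_lowerCost : Continuous fun x : G.Belief t × G.Presc 1 t =>
    ⨅ γ₁, G.lowerCost E t x.1 γ₁ x.2 :=
  continuous_iInf_of_compactSpace
    (f := fun (x : G.Belief t × G.Presc 1 t) γ₁ => G.lowerCost E t x.1 γ₁ x.2) <|
    (continuous_lowerCost E).comp
      (f := fun y : (G.Belief t × G.Presc 1 t) × G.Presc 0 t => (y.1.1, y.2, y.1.2)) (by fun_prop)

theorem upperFun_eq (ht : t < G.sys.T) (π : G.Belief t) :
    G.upperFun E t π = ⨅ γ₁, ⨆ γ₂, G.upperCost E t π γ₁ γ₂ := by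
  have h : G.sys.T - t = G.sys.T - (t + 1) + 1 := by omega
  rw [upperFun, h]
  rfl

theorem lowerFun_eq (ht : t < G.sys.T) (π : G.Belief t) :
    G.lowerFun E t π = ⨆ γ₂, ⨅ γ₁, G.lowerCost E t π γ₁ γ₂ := by
  have h : G.sys.T - t = G.sys.T - (t + 1) + 1 := by omega
  rw [lowerFun, h]
  rfl

theorem upperFun_horizon (π : G.Belief G.sys.T) : G.upperFun E G.sys.T π = 0 := by
  rw [upperFun, Nat.sub_self]
  rfl

theorem lowerFun_horizon (π : G.Belief G.sys.T) : G.lowerFun E G.sys.T π = 0 := by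
  rw [lowerFun, Nat.sub_self]
  rfl

/-! ### Selectors and optimality of belief-based strategies -/

/-- Measurable selection of a prescription that minimizes a continuous function. -/
theorem exists_measurable_minimizer {F : G.Belief t → G.Presc i t → ℝ}
    (hF : Continuous (Function.uncurry F)) :
    ∃ Ξ : G.Belief t → G.Presc i t, Measurable Ξ ∧ ∀ π γ, F π (Ξ π) ≤ F π γ := by
  -- The generating coordinates are the finitely many probabilities that a prescription assigns to
  -- an action at a private realization.
  refine exists_measurable_argmin
    (e := fun (k : Σ j : Fin (G.sys.N i), G.info.Priv t i j × G.sys.U t i j) (γ : G.Presc i t) =>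
      (γ k.1 k.2.1).1 k.2.2)
    (fun k => (continuous_apply k.2.2).comp (continuous_subtype_val.comp
      ((continuous_apply k.2.1).comp (continuous_apply k.1))))
    (fun g hg => measurable_pi_iff.2 fun j => measurable_pi_iff.2 fun p =>
      Measurable.subtype_mk (measurable_pi_iff.2 fun a => hg ⟨j, p, a⟩))
    (fun γ => (hF.comp (f := fun π => (π, γ)) (by fun_prop)).measurable)
    (fun π => hF.comp (f := fun γ => (π, γ)) (by fun_prop))

variable (G) in
theorem exists_measurable_upperSelector : ∃ Ξ₁ : ∀ t, G.Belief t → G.Presc 0 t,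
    (∀ t, Measurable (Ξ₁ t)) ∧ G.IsUpperSelector E Ξ₁ := by
  choose Ξ hm hmin using fun t => exists_measurable_minimizer
    (F := fun π γ₁ => ⨆ γ₂, G.upperCost E t π γ₁ γ₂) (continuous_iSup_upperCost (t := t) E)
  refine ⟨Ξ, hm, fun t ht π => ?_⟩
  have h : G.upperFun E t π = ⨆ γ₂, G.upperCost E t π (Ξ t π) γ₂ := by
    rw [upperFun_eq E ht]
    exact IsLeast.csInf_eq ⟨⟨_, rfl⟩, by rintro _ ⟨γ, rfl⟩; exact hmin t π γ⟩
  rw [h]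
  exact isGreatest_range_iSup (continuous_upperCost_right E π _)

variable (G) in
theorem exists_measurable_lowerSelector : ∃ Ξ₂ : ∀ t, G.Belief t → G.Presc 1 t,
    (∀ t, Measurable (Ξ₂ t)) ∧ G.IsLowerSelector E Ξ₂ := by
  choose Ξ hm hmin using fun t => exists_measurable_minimizer
    (F := fun π γ₂ => -⨅ γ₁, G.lowerCost E t π γ₁ γ₂) (continuous_iInf_lowerCost (t := t) E).neg
  refine ⟨Ξ, hm, fun t ht π => ?_⟩
  have h : G.lowerFun E t π = ⨅ γ₁, G.lowerCost E t π γ₁ (Ξ t π) := by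
    rw [lowerFun_eq E ht]
    exact IsGreatest.csSup_eq ⟨⟨_, rfl⟩, by rintro _ ⟨γ, rfl⟩; exact neg_le_neg_iff.1 (hmin t π γ)⟩
  rw [h]
  exact isLeast_range_iInf (continuous_lowerCost_left E π _)

theorem Presc.prob_le_one (γ : G.Presc i t) (p : G.info.TeamPriv t i) (a : G.sys.TeamAct t i) :
    γ.prob p a ≤ 1 :=
  Finset.prod_le_one (fun j _ => (γ j (p j)).2.1 _) fun j _ =>
    (Finset.single_le_sum (f := (γ j (p j)).1) (fun b _ => (γ j (p j)).2.1 b)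
      (Finset.mem_univ (a j))).trans_eq (γ j (p j)).2.2

theorem outcomeProb_le_noiseProb {n : ℕ} (χ₁ : G.Strategy 0) (χ₂ : G.Strategy 1)
    (ω : G.sys.Outcome n) : G.outcomeProb χ₁ χ₂ ω ≤ G.sys.noiseProb ω :=
  mul_le_of_le_one_right (noiseProb_nonneg ω) <| Finset.prod_le_one
    (fun _ _ => mul_nonneg (Presc.prob_nonneg _ _ _) (Presc.prob_nonneg _ _ _)) fun _ _ =>
      mul_le_one₀ (Presc.prob_le_one _ _ _) (Presc.prob_nonneg _ _ _) (Presc.prob_le_one _ _ _)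

-- Real-valued suprema and infima over strategies are meaningful only for bounded families. Each
-- action factor is at most one, so noise probabilities give a bound uniform in the strategies.
variable (G) in
theorem exists_abs_totalCost_le :
    ∃ B, ∀ (χ₁ : G.Strategy 0) (χ₂ : G.Strategy 1), |G.totalCost χ₁ χ₂| ≤ B := by
  refine ⟨∑ ω : G.sys.Outcome G.sys.T, G.sys.noiseProb ω *
    |∑ t : Fin G.sys.T, G.sys.cost t (ω.state t t.2.le) (ω.u t 0) (ω.u t 1)|, fun χ₁ χ₂ => ?_⟩
  refine (Finset.abs_sum_le_sum_abs _ _).trans (Finset.sum_le_sum fun ω _ => ?_)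
  rw [abs_mul, abs_of_nonneg (outcomeProb_nonneg χ₁ χ₂ ω)]
  exact mul_le_mul_of_nonneg_right (outcomeProb_le_noiseProb χ₁ χ₂ ω) (abs_nonneg _)

variable {E}

theorem IsUpperSelector.isMinMax {Ξ₁ : ∀ t, G.Belief t → G.Presc 0 t}
    (hΞ : G.IsUpperSelector E Ξ₁) : G.IsMinMax (G.beliefStrategy E Ξ₁) := by
  refine isGreatest_range_iInf_iSup (v := G.initialValue E (G.upperFun E)) (fun χ₂ => ?_)
    (fun χ₁ => ?_) fun χ₁ => ?_
  · exact totalCost_le_initialValue _ _ E (upperFun_horizon E) fun k hk c =>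
      (hΞ k hk _).2 ⟨_, rfl⟩
  -- A best response may depend on the opponent's current prescription: `χ₁` is fixed, so the reply
  -- can recompute that prescription from the common information and the history. Strategies need
  -- not be measurable, so plain choice suffices.
  · choose br hbr using fun t π γ₁ =>
      (isGreatest_range_iSup (continuous_upperCost_right (t := t) E π γ₁)).1
    refine ⟨fun t c H => br t (G.beliefOf E t c H) (χ₁ t c H),
      initialValue_le_totalCost _ _ E (upperFun_horizon E) fun k hk c => ?_⟩
    rw [upperFun_eq E hk]
    refine le_trans (ciInf_le ?_ (presc₁ χ₁ _ k c)) (hbr k _ _).ge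
    -- Compactness bounds the inner suprema below, as comparing the infimum with one of its terms
    -- requires.
    exact (isCompact_range ((continuous_iSup_upperCost E).comp
      (f := fun γ₁ => (playBelief χ₁ _ E k c, γ₁)) (by fun_prop))).bddBelow
  · obtain ⟨B, hB⟩ := exists_abs_totalCost_le G
    exact ⟨B, by rintro _ ⟨χ₂, rfl⟩; exact (abs_le.1 (hB χ₁ χ₂)).2⟩

theorem IsLowerSelector.isMaxMin {Ξ₂ : ∀ t, G.Belief t → G.Presc 1 t}
    (hΞ : G.IsLowerSelector E Ξ₂) : G.IsMaxMin (G.beliefStrategy E Ξ₂) := by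
  refine isLeast_range_iSup_iInf (J := fun χ₂ χ₁ => G.totalCost χ₁ χ₂)
    (v := G.initialValue E (G.lowerFun E)) (fun χ₁ => ?_) (fun χ₂ => ?_) fun χ₂ => ?_
  · exact initialValue_le_totalCost _ _ E (lowerFun_horizon E) fun k hk c =>
      (hΞ k hk _).2 ⟨_, rfl⟩
  -- The roles are reversed: the minimizer's reply recomputes the prescription that the fixed `χ₂`
  -- selects.
  · choose br hbr using fun t π γ₂ =>
      (isLeast_range_iInf (continuous_lowerCost_left (t := t) E π γ₂)).1
    refine ⟨fun t c H => br t (G.beliefOf E t c H) (χ₂ t c H),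
      totalCost_le_initialValue _ _ E (lowerFun_horizon E) fun k hk c => ?_⟩
    rw [lowerFun_eq E hk]
    refine le_trans (hbr k _ _).le (le_ciSup (f := fun γ₂ => ⨅ γ₁, G.lowerCost E k _ γ₁ γ₂) ?_
      (presc₂ _ χ₂ k c))
    exact (isCompact_range ((continuous_iInf_lowerCost E).comp
      (f := fun γ₂ => (playBelief _ χ₂ E k c, γ₂)) (by fun_prop))).bddAbove
  · obtain ⟨B, hB⟩ := exists_abs_totalCost_le G
    exact ⟨-B, by rintro _ ⟨χ₁, rfl⟩; exact (abs_le.1 (hB χ₁ χ₂)).1⟩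

end TeamGame

end

theorem theorem3 (G : TeamGame.{u}) (E : G.OffSupport) :
    (∃ Ξ₁ : ∀ t, G.Belief t → G.Presc 0 t,
      (∀ t, Measurable (Ξ₁ t)) ∧ G.IsUpperSelector E Ξ₁) ∧
    (∃ Ξ₂ : ∀ t, G.Belief t → G.Presc 1 t,
      (∀ t, Measurable (Ξ₂ t)) ∧ G.IsLowerSelector E Ξ₂) ∧
    (∀ Ξ₁ : ∀ t, G.Belief t → G.Presc 0 t,
      G.IsUpperSelector E Ξ₁ → G.IsMinMax (G.beliefStrategy E Ξ₁)) ∧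
    (∀ Ξ₂ : ∀ t, G.Belief t → G.Presc 1 t,
      G.IsLowerSelector E Ξ₂ → G.IsMaxMin (G.beliefStrategy E Ξ₂)) :=
  ⟨G.exists_measurable_upperSelector E, G.exists_measurable_lowerSelector E,
    fun _ h => h.isMinMax, fun _ h => h.isMaxMin⟩
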